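/- **Setting.** Let $n\ge 1$ and $\mathbb R^N=\mathbb R^{a_1}\oplus\cdots\oplus\mathbb R^{a_n}$ with all $a_l\ge1$; write $\mathbf x=(\mathbf x_1,\dots,\mathbf x_n)$, and let $J_l$ be the set of indices of the coordinates belonging to $\mathbb R^{a_l}$. Fix positive exponents $d_1,\dots,d_N$, the dilations $r\cdot \mathbf x=(r^{d_1}x_1,\dots,r^{d_N}x_N)$ for $r>0$ (acting also on each $\mathbb R^{a_l}$), and put $Q_l=\sum_{j\in J_l}d_j$, $N_l(\mathbf x_l)=\max_{j\in J_l}|x_j|^{1/d_j}$ and $[\![\bar\alpha_l]\!]=\sum_{j\in J_l}\alpha_jd_j$ for $\alpha\in\mathbb N^N$. For Schwartz functions let $\|\varphi\|_{[M]}$ denote the usual Schwartz norm of order $M$, $\sup\{(1+|\mathbf x|)^{k}|\partial^\beta\varphi(\mathbf x)|: k+|\beta|\le M,\ \mathbf x\in\mathbb R^N\}$ (up to constants depending only on $M$ and $N$). Functions and distributions are real valued, or all complex valued. **Flag kernels.** A distribution $\mathcal K\in\mathcal S'(\mathbb R^N)$ is a *flag kernel* (adapted to the standard flag $(0)\subset\mathbb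 R^{a_n}\subset\mathbb R^{a_{n-1}}\oplus\mathbb R^{a_n}\subset\cdots\subset\mathbb R^N$) if there are constants $A_m$ and, for every $L\subseteq\{1,\dots,n\}$ and $m\in\mathbb N$, constants $B_{L,m}$ and $s_{L,m}\in\mathbb N$ such that: (a) On test functions supported away from $\mathbf x_1=0$, $\mathcal K$ is given by integration against a function $K$ that is $C^\infty$ on $\{\mathbf x_1\ne0\}$, and for all $\alpha$ and $\mathbf x_1\neq0$ $$|\partial^\alpha K(\mathbf x)|\le A_{|\alpha|}\prod_{k=1}^n\big[N_1(\mathbf x_1)+\cdots+N_k(\mathbf x_k)\big]^{-Q_k-[\![\bar\alpha_k]\!]}.$$ (b) For every pair of complementary sets $L=\{l_1<\dots<l_\alpha\}$, $M=\{m_1<\dots<m_\beta\}$ of $\{1,\dots,n\}$, every $\psi\in C_0^\infty(\mathbb R^{a_{m_1}}\oplus\cdots\oplus\mathbb R^{a_{m_\beta}})$ and all $R_1,\dots,R_\beta>0$, with $\psi_R(\mathbf x_{m_1},\dots,\mathbf x_{m_\beta})=\psi(R_1\cdot\mathbf x_{m_1},\dots,R_\beta\cdot\mathbf x_{m_\beta})$,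 the distribution $\varphi\mapsto\langle\mathcal K,\psi_R\otimes\varphi\rangle$ on $\mathbb R^{a_{l_1}}\oplus\cdots\oplus\mathbb R^{a_{l_\alpha}}$ satisfies (a) for this decomposition, with constants $B_{L,m}\|\psi\|_{[s_{L,m}]}$, $m\in\mathbb N$, in place of $A_m$ (so independently of $R$). For $L=\emptyset$ this means $|\langle\mathcal K,\psi_R\rangle|\le B_{\emptyset,0}\|\psi\|_{[s_{\emptyset,0}]}$. The numbers $A_m$, $B_{L,m}$, $s_{L,m}$ are the *bounds* of the flag kernel. **Dilates and weak cancellation.** Let $\mathcal E_n=\{I=(i_1,\dots,i_n)\in\mathbb Z^n: i_1\le\cdots\le i_n\}$ and, for $I\in\mathcal E_n$, $$[\varphi]_I(\mathbf x)=2^{-\sum_lQ_li_l}\,\varphi(2^{-i_1}\cdot\mathbf x_1,\dots,2^{-i_n}\cdot\mathbf x_n).$$ A function $\varphi\in\mathcal S(\mathbb R^N)$ has *weak cancellation* relative to $I$ with parameter $\epsilon>0$ and normalization constants $(c_M,p_M)_{M\in\mathbb N}$, $p_M\in\mathbb N$, if $$\varphi=\sum_{\substack{A\sqcup B=\{1,\dots,n\}\\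 n\in A=\{\alpha_1,\dots,\alpha_r\}}}\Big(\prod_{s\in B}2^{-\epsilon(i_{s+1}-i_s)}\Big)\sum_{j_1\in J_{\alpha_1}}\cdots\sum_{j_r\in J_{\alpha_r}}\partial_{j_1}\cdots\partial_{j_r}\varphi_{A,B,j_1,\dots,j_r}$$ with $\varphi_{A,B,j_1,\dots,j_r}\in\mathcal S(\mathbb R^N)$ such that $\|\varphi_{A,B,j_1,\dots,j_r}\|_{[M]}\le c_M\|\varphi\|_{[M+p_M]}$ for all $M$. **Theorem.** For each $I\in\mathcal E_n$ let $\varphi^I\in\mathcal S(\mathbb R^N)$. Suppose that (i) for each $M$ there is $C_M$ with $\|\varphi^I\|_{[M]}\le C_M$ for all $I\in\mathcal E_n$; (ii) there are $\epsilon>0$ and normalization constants $(c_M,p_M)$, all independent of $I$, such that each $\varphi^I$ has weak cancellation relative to $I$ with parameter $\epsilon$ and these constants. Then: 1. For every finite set $F\subset\mathcal E_n$, the function $K_F=\sum_{I\in F}[\varphi^I]_I\in\mathcal S(\mathbb R^N)$ defines a flag kernel, with bounds independent of $F$. 2. There is a flag kernel $\mathcal K\in\mathcal S'(\mathbb R^N)$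 such that for every increasing sequence $F_1\subset F_2\subset\cdots$ of finite subsets of $\mathcal E_n$ with $\bigcup_mF_m=\mathcal E_n$ and every $\psi\in\mathcal S(\mathbb R^N)$ $$\lim_{m\to\infty}\sum_{I\in F_m}\int_{\mathbb R^N}[\varphi^I]_I(\mathbf x)\,\psi(\mathbf x)\,d\mathbf x=\langle\mathcal K,\psi\rangle .$$ In particular the limit exists and does not depend on the choice of the sets $F_m$. -/

import Mathlib

open scoped SchwartzMap ContDiff LineDeriv Topology

noncomputable section

namespace FlagKernel

/-! ### The space, its decomposition into blocks, and its dilations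

A decomposition `ℝ^N = ⊕ ℝ^{a i}` is given by block dimensions `a : ι → ℕ`, where `ι` is a finite
linearly ordered set of blocks (`Fin n` for the whole space, and a subset of it for the blocks that
remain once some of the variables have been integrated out). Coordinates are indexed by pairs
`⟨i, k⟩` (block, position in the block); the exponent of that coordinate is `d i k`. -/

/-- `ℝ^N = ⊕ ℝ^{a i}` with the Euclidean norm. -/
abbrev Space {ι : Type} (a : ι → ℕ) : Type := EuclideanSpace ℝ ((i : ι) × Fin (a i))

/-- Unit vector in the direction of the coordinate `p`. -/
abbrev unitVec {ι : Type} [LinearOrder ι] (a : ι → ℕ) (p : (i : ι) × Fin (a i)) : Space a :=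
  EuclideanSpace.single p (1 : ℝ)

/-- Homogeneous dimension `Q_i` of the `i`-th block. -/
def homDim {ι : Type} {a : ι → ℕ} (d : ∀ i, Fin (a i) → ℝ) (i : ι) : ℝ := ∑ k, d i k

/-- Homogeneous norm `N_i(x_i) = max_k |x_{i,k}|^{1/d_{i,k}}` of the `i`-th block of `x`. -/
def blockNorm {ι : Type} {a : ι → ℕ} (d : ∀ i, Fin (a i) → ℝ) (i : ι) (x : Space a) : ℝ :=
  ⨆ k : Fin (a i), |x ⟨i, k⟩| ^ (1 / d i k)

/-- The part `⟦α_i⟧` of the homogeneous degree which the derivative `∂_{c 0} ⋯ ∂_{c (m-1)}` has in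
the block `i`. -/
def blockDegree {ι : Type} [LinearOrder ι] {a : ι → ℕ} (d : ∀ i, Fin (a i) → ℝ) {m : ℕ}
    (c : Fin m → (i : ι) × Fin (a i)) (i : ι) : ℝ :=
  ∑ t : Fin m, if (c t).1 = i then d (c t).1 (c t).2 else 0

/-- The multi-parameter dilation `x ↦ (r_i · x_i)_i`, that is `x_{i,k} ↦ r_i ^ d_{i,k} x_{i,k}`, for
positive parameters `r_i`. -/
def dilation {ι : Type} [Fintype ι] {a : ι → ℕ} (d : ∀ i, Fin (a i) → ℝ) (r : ι → ℝ)
    (hr : ∀ i, 0 < r i) : Space a ≃L[ℝ] Space a :=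
  LinearEquiv.toContinuousLinearEquiv
    { toFun := fun x => WithLp.toLp 2 fun p => r p.1 ^ d p.1 p.2 * x p
      invFun := fun x => WithLp.toLp 2 fun p => (r p.1 ^ d p.1 p.2)⁻¹ * x p
      map_add' := fun x y => by ext p; simp [mul_add]
      map_smul' := fun s x => by ext p; simp [mul_left_comm]
      left_inv := fun x => by
        ext p
        simp [(Real.rpow_pos_of_pos (hr p.1) (d p.1 p.2)).ne']
      right_inv := fun x => by
        ext p
        simp [(Real.rpow_pos_of_pos (hr p.1) (d p.1 p.2)).ne'] }

/-- The coordinates of `x` in the blocks of `L`. -/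
def restrict {ι : Type} [Fintype ι] (a : ι → ℕ) (L : Finset ι) :
    Space a →L[ℝ] Space (fun i : L => a i) :=
  LinearMap.toContinuousLinearMap
    { toFun := fun x => WithLp.toLp 2 fun p => x ⟨p.1, p.2⟩
      map_add' := fun x y => by ext p; simp
      map_smul' := fun s x => by ext p; simp }

theorem norm_le_restrict {ι : Type} [Fintype ι] [LinearOrder ι] (a : ι → ℕ) (L : Finset ι)
    (x : Space a) : ‖x‖ ≤ ‖restrict a Lᶜ x‖ + ‖restrict a L x‖ := by
  have key : ‖x‖ ^ 2 = ‖restrict a Lᶜ x‖ ^ 2 + ‖restrict a L x‖ ^ 2 := by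
    simp only [EuclideanSpace.norm_sq_eq, Fintype.sum_sigma]
    have h : ∀ S : Finset ι, ∑ i : S, ∑ k : Fin (a i), ‖(restrict a S x) ⟨i, k⟩‖ ^ 2
        = ∑ i ∈ S, ∑ k : Fin (a i), ‖x ⟨i, k⟩‖ ^ 2 := fun S =>
      Finset.sum_coe_sort S (fun i => ∑ k : Fin (a i), ‖x ⟨i, k⟩‖ ^ 2)
    rw [h, h, add_comm, Finset.sum_add_sum_compl]
  nlinarith [norm_nonneg x, norm_nonneg (restrict a Lᶜ x), norm_nonneg (restrict a L x)]

/-! ### Schwartz functions and tempered distributions -/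

/-- The Schwartz norm `‖φ‖_[M]`: the largest of the seminorms
`sup_x ‖x‖ ^ k * ‖iteratedFDeriv ℝ l φ x‖` with `k + l ≤ M`. -/
def schwartzNorm {𝕜 : Type} [RCLike 𝕜] {ι : Type} [Fintype ι] {a : ι → ℕ} (M : ℕ)
    (φ : 𝓢(Space a, 𝕜)) : ℝ :=
  ((Finset.range (M + 1) ×ˢ Finset.range (M + 1)).filter (fun q => q.1 + q.2 ≤ M)).sup
    (schwartzSeminormFamily 𝕜 (Space a) 𝕜) φ

/-- The function `(f ⊗ g)(x) = f(x'') g(x')`, where `x'` consists of the blocks of `x` in `L` and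
`x''` of the remaining ones. -/
def tensor {𝕜 : Type} [RCLike 𝕜] {ι : Type} [Fintype ι] [LinearOrder ι] {a : ι → ℕ} (L : Finset ι)
    (f : 𝓢(Space (fun i : (Lᶜ : Finset ι) => a i), 𝕜)) (g : 𝓢(Space (fun i : L => a i), 𝕜)) :
    𝓢(Space a, 𝕜) where
  toFun x := f (restrict a Lᶜ x) * g (restrict a L x)
  smooth' := ((f.smooth _).comp (restrict a Lᶜ).contDiff).mul
    ((g.smooth _).comp (restrict a L).contDiff)
  decay' := by
    intro k n
    set P := restrict a Lᶜ
    set P' := restrict a L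
    let pf : ℕ → ℕ → ℝ := fun k i => SchwartzMap.seminorm ℝ k i f
    let pg : ℕ → ℕ → ℝ := fun k i => SchwartzMap.seminorm ℝ k i g
    refine ⟨∑ i ∈ Finset.range (n + 1), (n.choose i : ℝ) * (2 ^ (k - 1) *
      (pf k i * pg 0 (n - i) + pf 0 i * pg k (n - i)) * (‖P‖ ^ i * ‖P'‖ ^ (n - i))), fun x => ?_⟩
    have htop : ∀ q : ℕ, (q : WithTop ℕ∞) ≤ ∞ := fun q => by exact_mod_cast le_top
    have hf : ContDiff ℝ ∞ (fun x => f (P x)) := (f.smooth _).comp P.contDiff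
    have hg : ContDiff ℝ ∞ (fun x => g (P' x)) := (g.smooth _).comp P'.contDiff
    have h1 := norm_iteratedFDeriv_mul_le (𝕜 := ℝ) hf hg x (n := n) (htop n)
    refine (mul_le_mul_of_nonneg_left h1 (by positivity)).trans ?_
    rw [Finset.mul_sum]
    refine Finset.sum_le_sum fun i _ => ?_
    have e1 : ‖iteratedFDeriv ℝ i (fun x => f (P x)) x‖
        ≤ ‖iteratedFDeriv ℝ i f (P x)‖ * ‖P‖ ^ i := by
      have := P.iteratedFDeriv_comp_right (f := f) (f.smooth ⊤) x (i := i)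
        (htop i)
      change ‖iteratedFDeriv ℝ i (f ∘ P) x‖ ≤ _
      rw [this]
      simpa using (iteratedFDeriv ℝ i f (P x)).norm_compContinuousLinearMap_le (fun _ => P)
    have e2 : ‖iteratedFDeriv ℝ (n - i) (fun x => g (P' x)) x‖
        ≤ ‖iteratedFDeriv ℝ (n - i) g (P' x)‖ * ‖P'‖ ^ (n - i) := by
      have := P'.iteratedFDeriv_comp_right (f := g) (g.smooth ⊤) x (i := n - i)
        (htop (n - i))
      change ‖iteratedFDeriv ℝ (n - i) (g ∘ P') x‖ ≤ _
      rw [this]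
      simpa using (iteratedFDeriv ℝ (n - i) g (P' x)).norm_compContinuousLinearMap_le (fun _ => P')
    set u := ‖iteratedFDeriv ℝ i f (P x)‖
    set v := ‖iteratedFDeriv ℝ (n - i) g (P' x)‖
    have hx : ‖x‖ ^ k ≤ 2 ^ (k - 1) * (‖P x‖ ^ k + ‖P' x‖ ^ k) :=
      (pow_le_pow_left₀ (norm_nonneg _) (norm_le_restrict a L x) k).trans
        (add_pow_le (norm_nonneg _) (norm_nonneg _) k)
    have f0 : u ≤ pf 0 i := by simpa using SchwartzMap.le_seminorm ℝ 0 i f (P x)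
    have fk : ‖P x‖ ^ k * u ≤ pf k i := SchwartzMap.le_seminorm ℝ k i f (P x)
    have g0 : v ≤ pg 0 (n - i) := by simpa using SchwartzMap.le_seminorm ℝ 0 (n - i) g (P' x)
    have gk : ‖P' x‖ ^ k * v ≤ pg k (n - i) := SchwartzMap.le_seminorm ℝ k (n - i) g (P' x)
    have hu : 0 ≤ u := norm_nonneg _
    have hv : 0 ≤ v := norm_nonneg _
    have A1 : (‖P x‖ ^ k * u) * v ≤ pf k i * pg 0 (n - i) :=
      mul_le_mul fk g0 hv ((mul_nonneg (by positivity) hu).trans fk)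
    have A2 : u * (‖P' x‖ ^ k * v) ≤ pf 0 i * pg k (n - i) :=
      mul_le_mul f0 gk (mul_nonneg (by positivity) hv) (hu.trans f0)
    calc ‖x‖ ^ k * (↑(n.choose i) * ‖iteratedFDeriv ℝ i (fun x => f (P x)) x‖ *
            ‖iteratedFDeriv ℝ (n - i) (fun x => g (P' x)) x‖)
        ≤ (2 ^ (k - 1) * (‖P x‖ ^ k + ‖P' x‖ ^ k)) *
            (↑(n.choose i) * (u * ‖P‖ ^ i) * (v * ‖P'‖ ^ (n - i))) := by gcongr
      _ = ↑(n.choose i) * (2 ^ (k - 1) * ((‖P x‖ ^ k * u) * v + u * (‖P' x‖ ^ k * v)) *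
            (‖P‖ ^ i * ‖P'‖ ^ (n - i))) := by ring
      _ ≤ _ := by gcongr

/-- The tempered distribution `ψ ↦ ∫ f ψ` defined by a Schwartz function `f`. -/
def toDistribution {𝕜 : Type} [RCLike 𝕜] {ι : Type} [Fintype ι] {a : ι → ℕ}
    (f : 𝓢(Space a, 𝕜)) : 𝓢(Space a, 𝕜) →L[𝕜] 𝕜 :=
  (SchwartzMap.integralCLM 𝕜 MeasureTheory.volume).comp
    (SchwartzMap.pairing (ContinuousLinearMap.mul 𝕜 𝕜) f)

theorem toDistribution_apply {𝕜 : Type} [RCLike 𝕜] {ι : Type} [Fintype ι] {a : ι → ℕ}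
    (f ψ : 𝓢(Space a, 𝕜)) : toDistribution f ψ = ∫ x, f x * ψ x := rfl

/-! ### Flag kernels -/

/-- The subspace `x_1 = 0`, where `x_1` is the first block of `x` (and the empty set if there is no
block at all, in which case `Space a` is a point). -/
def singularSet {ι : Type} [LinearOrder ι] (a : ι → ℕ) : Set (Space a) :=
  {x | ∃ i, IsMin i ∧ ∀ k, x ⟨i, k⟩ = 0}

/-- The differential inequalities of a flag kernel, with constants `C`: on test functions which are
supported away from `x_1 = 0` the functional `T` is integration against a function `K` which is
smooth off `x_1 = 0`, and for `x_1 ≠ 0`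
`|∂^α K(x)| ≤ C_{|α|} ∏_i (N_1(x_1) + ⋯ + N_i(x_i)) ^ (-Q_i - ⟦α_i⟧)`.
The derivative `∂^α` is written as `∂_{c 0} ⋯ ∂_{c (m-1)}`, so `m = |α|` and `α_p` is the number of
`t` with `c t = p`. If there are no blocks, `T` is a number and its modulus is at most `C_0`. -/
def DiffIneq {𝕜 : Type} [RCLike 𝕜] {ι : Type} [Fintype ι] [LinearOrder ι] (a : ι → ℕ)
    (d : ∀ i, Fin (a i) → ℝ) (T : 𝓢(Space a, 𝕜) → 𝕜) (C : ℕ → ℝ) : Prop :=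
  ∃ K : Space a → 𝕜,
    ContDiffOn ℝ ∞ K (singularSet a)ᶜ ∧
    (∀ (m : ℕ) (c : Fin m → (i : ι) × Fin (a i)) (x : Space a), x ∉ singularSet a →
      ‖iteratedFDeriv ℝ m K x (fun t => unitVec a (c t))‖ ≤
        C m * ∏ i, (∑ j with j ≤ i, blockNorm d j x) ^ (-(homDim d i + blockDegree d c i))) ∧
    ∀ φ : 𝓢(Space a, 𝕜),
      (∃ δ > 0, ∀ x, φ x ≠ 0 → ∀ i, IsMin i → δ ≤ blockNorm d i x) →
      MeasureTheory.Integrable (fun x => K x * φ x) ∧ T φ = ∫ x, K x * φ x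

/-- `𝓚` is a flag kernel with flag kernel constants `A` and `B`, `s`. In the cancellation
conditions, `L` and `Lᶜ` are complementary sets of blocks, `ψ` is a smooth function with compact
support in the variables of `Lᶜ`, and `R` are positive dilation parameters; the distribution
`φ ↦ ⟨𝓚, ψ_R ⊗ φ⟩` in the variables of `L` satisfies the differential inequalities for the blocks in
`L`, where the constant at derivatives of order `m` is `B L m` times a Schwartz norm of `ψ` of order
`s L m`, hence independent of `R`. -/
structure IsFlagKernelWith {𝕜 : Type} [RCLike 𝕜] {ι : Type} [Fintype ι] [LinearOrder ι] (a : ι → ℕ)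
    (d : ∀ i, Fin (a i) → ℝ) (𝓚 : 𝓢(Space a, 𝕜) →L[𝕜] 𝕜)
    (A : ℕ → ℝ) (B : Finset ι → ℕ → ℝ) (s : Finset ι → ℕ → ℕ) : Prop where
  size : DiffIneq a d (fun φ => 𝓚 φ) A
  cancellation : ∀ (L : Finset ι) (ψ : 𝓢(Space (fun i : (Lᶜ : Finset ι) => a i), 𝕜)),
    HasCompactSupport ψ →
    ∀ (R : (Lᶜ : Finset ι) → ℝ) (hR : ∀ i, 0 < R i),
      DiffIneq (fun i : L => a i) (fun i : L => d i)
        (fun φ => 𝓚 (tensor L (SchwartzMap.compCLMOfContinuousLinearEquiv 𝕜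
          (dilation (fun i : (Lᶜ : Finset ι) => d i) R hR) ψ) φ))
        (fun m => B L m * schwartzNorm (s L m) ψ)

/-- `𝓚` is a flag kernel adapted to the standard flag of the decomposition `a`. -/
def IsFlagKernel {𝕜 : Type} [RCLike 𝕜] {ι : Type} [Fintype ι] [LinearOrder ι] (a : ι → ℕ)
    (d : ∀ i, Fin (a i) → ℝ) (𝓚 : 𝓢(Space a, 𝕜) →L[𝕜] 𝕜) : Prop :=
  ∃ A B s, IsFlagKernelWith a d 𝓚 A B s

/-! ### Dyadic dilates and weak cancellation -/

/-- The set `𝓔_n` of increasing `n`-tuples of integers. -/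
abbrev Index (n : ℕ) : Type := {I : Fin n → ℤ // Monotone I}

/-- The `L¹`-normalized dilate
`[φ]_I (x) = 2 ^ (-∑ Q_l i_l) φ (2 ^ (-i_1) · x_1, …, 2 ^ (-i_n) · x_n)`. -/
def dyadicDilate {𝕜 : Type} [RCLike 𝕜] {n : ℕ} {a : Fin n → ℕ} (d : ∀ l, Fin (a l) → ℝ)
    (I : Index n) (φ : 𝓢(Space a, 𝕜)) : 𝓢(Space a, 𝕜) :=
  ((2 : ℝ) ^ (-∑ l, homDim d l * (I.1 l : ℝ))) •
    SchwartzMap.compCLMOfContinuousLinearEquiv 𝕜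
      (dilation d (fun l => (2 : ℝ) ^ (-I.1 l)) (fun _ => by positivity)) φ

open Classical in
/-- `φ` has weak cancellation with parameter `ε` relative to `I`, where the functions in the
decomposition are normalized relative to `φ` with constants `c M` and shifts `p M`. The set `A`
contains the last block, `B = Aᶜ`, and `j` chooses one coordinate from each block in `A`. -/
def HasWeakCancellation {𝕜 : Type} [RCLike 𝕜] {n : ℕ} {a : Fin n → ℕ} (c : ℕ → ℝ) (p : ℕ → ℕ)
    (ε : ℝ) (I : Index n) (φ : 𝓢(Space a, 𝕜)) : Prop :=
  ∃ η : (A : Finset (Fin n)) → (∀ i : A, Fin (a i)) → 𝓢(Space a, 𝕜),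
    (∀ A j M, schwartzNorm M (η A j) ≤ c M * schwartzNorm (M + p M) φ) ∧
    φ = ∑ A : Finset (Fin n) with ∀ i, IsMax i → i ∈ A,
      (∏ l ∈ Aᶜ, (2 : ℝ) ^ (-ε * ((I.1 (Order.succ l) : ℝ) - (I.1 l : ℝ)))) •
        ∑ j : (∀ i : A, Fin (a i)),
          ∂^{fun t : Fin A.card =>
            unitVec a ⟨(A.orderIsoOfFin rfl t : Fin n), j (A.orderIsoOfFin rfl t)⟩} (η A j)

end FlagKernel

end

noncomputable section

namespace FlagKernel

/-! ### Sums over dyadic scales -/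

/-! Every estimate is made one scale at a time and then summed over `Index n`. Put `q_l = Q_l +
⟦α_l⟧` and `D_l = N_1 + ⋯ + N_l`.

Size. Since `i_1 ≤ ⋯ ≤ i_n`, Schwartz decay in the dilated variable `2^{-I} · x` gives decay in each
`2^{-i_l} D_l` (`exists_decay_le_scaleWeight`). Hence `∂^α [φ^I]_I` is bounded by a product over `l`
of `scaleWeight q_l i_l D_l`. Each factor decays geometrically away from `2^{i_l} ≈ D_l` and sums
over `i_l ∈ ℤ` to a multiple of `D_l^{-q_l}`. No cancellation is needed here.

Cancellation conditions. Once the blocks outside `L` are integrated against `ψ_R`, the blocks in `L`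
keep these weights, but nothing controls the scales `i_l` with `l ∉ L`. Weak cancellation supplies
the missing decay. For `l ∈ A` there is a derivative in block `l`. If `2^{i_l} R_l ≤ 1`, it is
integrated by parts onto `ψ_R`, which varies more slowly, and gains a power of `2^{i_l} R_l`. If
`2^{i_l} R_l > 1`, the small support scale of `ψ_R` already gives a gain. So the factor is at most
`2^{-δ |i_l + log₂ R_l|}`, where `δ` bounds all exponents from below
(`exists_partialIntegral_dilate_le`). For `l ∈ B` the factor `2^{-ε (i_{l+1} - i_l)}` is given. As
`n ∈ A`, the scales in `L ∪ A` and the differences at the other indices determine `I`, so the sum is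
dominated by a product of convergent one-dimensional sums, uniformly in `R`
(`exists_sum_flagWeight_le`).

Convergence. The case `L = ∅` bounds the sum of the moduli of the pairings with a test function by
one Schwartz norm. The series therefore converges unconditionally to a tempered distribution, and
`diffIneq_of_hasSum` identifies its kernel with the pointwise sum. All constants depend only on
bounds for the `φ^I` and their decompositions, so replacing some `φ^I` by `0` leaves them unchanged.
This treats finite sums together with the full one. -/

theorem exists_sum_two_rpow_neg_abs_le {δ : ℝ} (hδ : 0 < δ) :
    ∃ C : ℝ, 0 < C ∧ ∀ (r : ℝ) (T : Finset ℤ), ∑ i ∈ T, (2 : ℝ) ^ (-δ * |(i : ℝ) + r|) ≤ C := by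
  set x : ℝ := 2 ^ (-δ) with hx
  have hx0 : 0 < x := by positivity
  have hx1 : x < 1 := Real.rpow_lt_one_of_one_lt_of_neg (by norm_num) (by linarith)
  have hs : Summable fun i : ℤ => x ^ i.natAbs := by
    have h := summable_geometric_of_lt_one hx0.le hx1
    exact Summable.of_nat_of_neg (by simpa using h) (by simpa using h)
  refine ⟨2 ^ δ * ∑' i : ℤ, x ^ i.natAbs, mul_pos (by positivity)
    (hs.tsum_pos (fun i => by positivity) 0 (by positivity)), fun r T => ?_⟩
  have key : ∀ i : ℤ, (2 : ℝ) ^ (-δ * |(i : ℝ) + r|) ≤ 2 ^ δ * x ^ (i + ⌊r⌋).natAbs := by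
    intro i
    rw [hx, ← Real.rpow_natCast, ← Real.rpow_mul (by norm_num), ← Real.rpow_add (by norm_num)]
    apply Real.rpow_le_rpow_of_exponent_le (by norm_num)
    have h1 : ((i + ⌊r⌋).natAbs : ℝ) = |(i : ℝ) + ⌊r⌋| := by
      rw [Nat.cast_natAbs]; push_cast; rfl
    have h2 : |(i : ℝ) + ⌊r⌋| ≤ |(i : ℝ) + r| + 1 := by
      have : (i : ℝ) + ⌊r⌋ = ((i : ℝ) + r) + (⌊r⌋ - r) := by ring
      rw [this]
      refine (abs_add_le _ _).trans (add_le_add le_rfl ?_)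
      rw [abs_le]
      constructor <;> linarith [Int.floor_le r, Int.lt_floor_add_one r]
    rw [h1]
    nlinarith
  calc ∑ i ∈ T, (2 : ℝ) ^ (-δ * |(i : ℝ) + r|)
      ≤ ∑ i ∈ T, 2 ^ δ * x ^ (i + ⌊r⌋).natAbs := Finset.sum_le_sum fun i _ => key i
    _ = 2 ^ δ * ∑ i ∈ T.map (Equiv.addRight ⌊r⌋).toEmbedding, x ^ i.natAbs := by
        simp [Finset.mul_sum]
    _ ≤ _ := by
        gcongr
        exact hs.sum_le_tsum _ fun i _ => by positivity

/-- The contribution of the scale `2 ^ i` to the size of a homogeneous kernel of degree `-q` at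
distance `D` from its singularity. -/
def scaleWeight (q : ℝ) (i : ℤ) (D : ℝ) : ℝ :=
  2 ^ (-q * i) * (1 + 2 ^ (-(i : ℝ)) * D) ^ (-(q + 1))

theorem scaleWeight_nonneg (q : ℝ) (i : ℤ) {D : ℝ} (hD : 0 ≤ D) : 0 ≤ scaleWeight q i D := by
  unfold scaleWeight; positivity

theorem scaleWeight_anti {q : ℝ} (hq : 0 ≤ q) (i : ℤ) {D D' : ℝ} (hD : 0 ≤ D) (h : D ≤ D') :
    scaleWeight q i D' ≤ scaleWeight q i D := by
  unfold scaleWeight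
  gcongr ?_ * ?_
  apply Real.rpow_le_rpow_of_nonpos (by positivity) _ (by linarith)
  gcongr

/-- With `s = log₂ D - i`, the prefactor is `D^{-q} 2^{qs}`, which decays for `s ≤ 0`. For `s ≥ 0`
the power `-(q + 1)` outweighs it and leaves `2^{-s}`. This is why the exponent in `scaleWeight`
exceeds `q`. -/
theorem scaleWeight_le {q D : ℝ} (hq : 0 < q) (hD : 0 < D) (i : ℤ) :
    scaleWeight q i D ≤ D ^ (-q) * 2 ^ (-(min q 1) * |(i : ℝ) + -Real.logb 2 D|) := by
  obtain ⟨s, hs⟩ : ∃ s, s = Real.logb 2 D - i := ⟨_, rfl⟩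
  have hD2 : D = 2 ^ (Real.logb 2 D) :=
    (Real.rpow_logb (by norm_num) (by norm_num) hD).symm
  have h1 : (2 : ℝ) ^ (-(i : ℝ)) * D = 2 ^ s := by
    conv_lhs => rw [hD2]
    rw [← Real.rpow_add (by norm_num), hs]; congr 1; ring
  have h2 : (2 : ℝ) ^ (-q * i) = D ^ (-q) * 2 ^ (q * s) := by
    conv_rhs => rw [hD2]
    rw [← Real.rpow_mul (by norm_num), ← Real.rpow_add (by norm_num), hs]
    congr 1; ring
  have h3 : |(i : ℝ) + -Real.logb 2 D| = |s| := by rw [hs, abs_sub_comm]; rfl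
  rw [scaleWeight, h1, h2, h3, mul_assoc]
  refine mul_le_mul_of_nonneg_left ?_ (by positivity)
  have hs0 : (0 : ℝ) < 2 ^ s := by positivity
  rcases le_total s 0 with h | h
  · calc (2 : ℝ) ^ (q * s) * (1 + 2 ^ s) ^ (-(q + 1)) ≤ 2 ^ (q * s) * 1 := by
          gcongr
          exact Real.rpow_le_one_of_one_le_of_nonpos (by linarith) (by linarith)
      _ ≤ _ := by
          rw [mul_one]
          apply Real.rpow_le_rpow_of_exponent_le (by norm_num)
          rw [abs_of_nonpos h]
          nlinarith [min_le_left q 1]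
  · calc (2 : ℝ) ^ (q * s) * (1 + 2 ^ s) ^ (-(q + 1)) ≤ 2 ^ (q * s) * (2 ^ s) ^ (-(q + 1)) := by
          gcongr ?_ * ?_
          exact Real.rpow_le_rpow_of_nonpos hs0 (by linarith) (by linarith)
      _ ≤ _ := by
          rw [← Real.rpow_mul (by norm_num), ← Real.rpow_add (by norm_num)]
          apply Real.rpow_le_rpow_of_exponent_le (by norm_num)
          rw [abs_of_nonneg h]
          nlinarith [min_le_right q 1]

/-- Injectivity embeds the index set in `κ → ℤ`. Enlarging the image to a box only adds nonnegative
terms, and over a box the sum of products factors. -/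
theorem sum_prod_le_of_injective {α κ : Type*} [Fintype κ] [DecidableEq κ] (J : α → κ → ℤ)
    (hJ : Function.Injective J) (G : κ → ℤ → ℝ) (hG : ∀ k i, 0 ≤ G k i) (C : κ → ℝ)
    (hC : ∀ k (T : Finset ℤ), ∑ i ∈ T, G k i ≤ C k) (F : Finset α) :
    ∑ e ∈ F, ∏ k, G k (J e k) ≤ ∏ k, C k := by
  classical
  set T : κ → Finset ℤ := fun k => F.image fun e => J e k
  calc ∑ e ∈ F, ∏ k, G k (J e k) = ∑ j ∈ F.image J, ∏ k, G k (j k) := by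
        rw [Finset.sum_image hJ.injOn]
    _ ≤ ∑ j ∈ Fintype.piFinset T, ∏ k, G k (j k) := by
        apply Finset.sum_le_sum_of_subset_of_nonneg
        · intro j hj
          obtain ⟨e, he, rfl⟩ := Finset.mem_image.1 hj
          exact Fintype.mem_piFinset.2 fun k => Finset.mem_image_of_mem (fun e => J e k) he
        · exact fun j _ _ => Finset.prod_nonneg fun k _ => hG _ _
    _ = ∏ k, ∑ i ∈ T k, G k i := (Finset.prod_univ_sum T G).symm
    _ ≤ _ := Finset.prod_le_prod (fun k _ => Finset.sum_nonneg fun i _ => hG _ _)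
        fun k _ => hC k _

/-! ### Block norms -/

section BlockNorm

variable {ι : Type} {a : ι → ℕ} (d : ∀ i, Fin (a i) → ℝ)

theorem blockNorm_nonneg (i : ι) (x : Space a) : 0 ≤ blockNorm d i x :=
  Real.iSup_nonneg fun _ => by positivity

theorem rpow_le_blockNorm (i : ι) (k : Fin (a i)) (x : Space a) :
    |x ⟨i, k⟩| ^ (1 / d i k) ≤ blockNorm d i x :=
  le_ciSup (f := fun k : Fin (a i) => |x ⟨i, k⟩| ^ (1 / d i k)) (Set.finite_range _).bddAbove k

/-- The sum `N_1(x_1) + ⋯ + N_i(x_i)`. -/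
def flagNorm [Fintype ι] [LinearOrder ι] (i : ι) (x : Space a) : ℝ :=
  ∑ j with j ≤ i, blockNorm d j x

variable [Fintype ι] [LinearOrder ι]

theorem flagNorm_nonneg (i : ι) (x : Space a) : 0 ≤ flagNorm d i x :=
  Finset.sum_nonneg fun _ _ => blockNorm_nonneg d _ x

theorem blockNorm_le_flagNorm {i j : ι} (h : j ≤ i) (x : Space a) :
    blockNorm d j x ≤ flagNorm d i x :=
  Finset.single_le_sum (f := fun j => blockNorm d j x) (fun _ _ => blockNorm_nonneg d _ x)
    (by simpa using h)

theorem le_flagNorm_of_isMin {δ : ℝ} {x : Space a} (h : ∀ i, IsMin i → δ ≤ blockNorm d i x)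
    (i : ι) : δ ≤ flagNorm d i x := by
  have : Nonempty ι := ⟨i⟩
  obtain ⟨j, hj⟩ := Finite.exists_min (id : ι → ι)
  exact (h j fun k _ => hj k).trans (blockNorm_le_flagNorm d (hj i) x)

/-- Every `flagNorm` contains the first block, one coordinate of which stays away from zero near
`x₀`. -/
theorem exists_ball_le_flagNorm (x₀ : Space a) (hx₀ : x₀ ∉ singularSet a) :
    ∃ r > 0, ∃ δ > 0, ∀ x ∈ Metric.ball x₀ r, x ∉ singularSet a ∧ ∀ i, δ ≤ flagNorm d i x := by
  rcases isEmpty_or_nonempty ι with hι | hι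
  · exact ⟨1, one_pos, 1, one_pos, fun x _ => ⟨fun ⟨i, _⟩ => hι.elim i, fun i => hι.elim i⟩⟩
  obtain ⟨j, hj⟩ := Finite.exists_min (id : ι → ι)
  have hj' : IsMin j := fun k _ => hj k
  obtain ⟨k, hk⟩ : ∃ k, x₀ ⟨j, k⟩ ≠ 0 := by
    by_contra! h
    exact hx₀ ⟨j, hj', h⟩
  have h0 : 0 < |x₀ ⟨j, k⟩| / 2 := by positivity
  -- The two powers cover both signs of `1 / d j k`, as positivity of the exponents is not assumed
  -- here.
  refine ⟨|x₀ ⟨j, k⟩| / 2, h0, (|x₀ ⟨j, k⟩| / 2) ^ (1 / d j k) ⊓ (|x₀ ⟨j, k⟩| * 2) ^ (1 / d j k),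
    by positivity,
    fun x hx => ?_⟩
  have h1 : |x ⟨j, k⟩ - x₀ ⟨j, k⟩| < |x₀ ⟨j, k⟩| / 2 := by
    have := PiLp.norm_apply_le (x - x₀) ⟨j, k⟩
    rw [mem_ball_iff_norm] at hx
    exact this.trans_lt hx
  have h2 : |x₀ ⟨j, k⟩| / 2 ≤ |x ⟨j, k⟩| := by
    have := abs_sub_abs_le_abs_sub (x₀ ⟨j, k⟩) (x ⟨j, k⟩)
    rw [abs_sub_comm] at this
    linarith
  have h3 : |x ⟨j, k⟩| ≤ |x₀ ⟨j, k⟩| * 2 := by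
    have := abs_sub_abs_le_abs_sub (x ⟨j, k⟩) (x₀ ⟨j, k⟩)
    linarith [abs_nonneg (x₀ ⟨j, k⟩)]
  refine ⟨fun ⟨i, hi, hi'⟩ => ?_, fun i => ?_⟩
  · obtain rfl : i = j := le_antisymm (hi (hj i)) (hj i)
    rw [hi' k, abs_zero] at h2
    exact h0.not_ge h2
  · refine le_trans ?_ ((rpow_le_blockNorm d j k x).trans (blockNorm_le_flagNorm d (hj i) x))
    rcases le_total 0 (1 / d j k) with h | h
    · exact inf_le_left.trans (Real.rpow_le_rpow h0.le h2 h)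
    · exact inf_le_right.trans (Real.rpow_le_rpow_of_nonpos (h0.trans_le h2) h3 h)

theorem flagNorm_pos {x : Space a} (hx : x ∉ singularSet a) (i : ι) : 0 < flagNorm d i x := by
  obtain ⟨r, hr, δ, hδ, h⟩ := exists_ball_le_flagNorm d x hx
  exact hδ.trans_le ((h x (Metric.mem_ball_self hr)).2 i)

end BlockNorm

/-! ### Series of smooth functions -/

/-- Expanding all arguments in the standard basis reduces the operator norm to coordinate
derivatives, which are what the single-scale bounds control. -/
theorem norm_multilinear_le_sum {𝕜 : Type} [RCLike 𝕜] {κ : Type} [Fintype κ] [DecidableEq κ] {m : ℕ}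
    (f : ContinuousMultilinearMap ℝ (fun _ : Fin m => EuclideanSpace ℝ κ) 𝕜) :
    ‖f‖ ≤ ∑ c : Fin m → κ, ‖f fun t => EuclideanSpace.single (c t) (1 : ℝ)‖ := by
  refine f.opNorm_le_bound (Finset.sum_nonneg fun _ _ => norm_nonneg _) fun v => ?_
  have hv : v = fun t => ∑ p, v t p • EuclideanSpace.single p (1 : ℝ) := by
    ext t p
    simp [Pi.single_apply]
  conv_lhs => rw [hv]
  rw [ContinuousMultilinearMap.map_sum, Finset.sum_mul]
  refine (norm_sum_le _ _).trans (Finset.sum_le_sum fun c _ => ?_)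
  rw [f.map_smul_univ (fun t => v t (c t)), norm_smul, mul_comm, norm_prod]
  gcongr with t
  exact PiLp.norm_apply_le (v t) (c t)

/-- Termwise differentiation at every order. It is localized to `s` because the summable majorants
exist only locally, away from the singular set. -/
theorem hasFTaylorSeriesUpToOn_tsum {α E F : Type*} [NormedAddCommGroup E] [NormedSpace ℝ E]
    [NormedAddCommGroup F] [NormedSpace ℝ F] [CompleteSpace F] {g : α → E → F}
    (hg : ∀ e, ContDiff ℝ ∞ (g e)) {s : Set E} (hs : IsOpen s) (hs' : IsPreconnected s)
    {u : ℕ → α → ℝ} (hu : ∀ m, Summable (u m))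
    (h : ∀ m e, ∀ x ∈ s, ‖iteratedFDeriv ℝ m (g e) x‖ ≤ u m e) :
    HasFTaylorSeriesUpToOn ∞ (fun x => ∑' e, g e x)
      (fun x m => ∑' e, iteratedFDeriv ℝ m (g e) x) s := by
  have hsum : ∀ m, ∀ x ∈ s, Summable fun e => iteratedFDeriv ℝ m (g e) x := fun m x hx =>
    (hu m).of_norm_bounded fun e => h m e x hx
  have hD : ∀ m, ∀ x ∈ s, HasFDerivAt (fun y => ∑' e, iteratedFDeriv ℝ m (g e) y)
      (∑' e, iteratedFDeriv ℝ (m + 1) (g e) x).curryLeft x := by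
    intro m x hx
    have e1 : (∑' e, iteratedFDeriv ℝ (m + 1) (g e) x).curryLeft
        = ∑' e, fderiv ℝ (iteratedFDeriv ℝ m (g e)) x := by
      have h2 : ∀ e, fderiv ℝ (iteratedFDeriv ℝ m (g e)) x =
          continuousMultilinearCurryLeftEquiv ℝ (fun _ : Fin (m + 1) => E) F
            (iteratedFDeriv ℝ (m + 1) (g e) x) := by
        intro e
        rw [fderiv_iteratedFDeriv]; rfl
      simp_rw [h2]
      exact ((continuousMultilinearCurryLeftEquiv ℝ (fun _ : Fin (m + 1) => E) F
        ).toContinuousLinearEquiv.toContinuousLinearMap.hasSum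
          (hsum (m + 1) x hx).hasSum).tsum_eq.symm
    rw [e1]
    refine hasFDerivAt_tsum_of_isPreconnected (hu (m + 1)) hs hs' (fun e y _ => ?_)
      (fun e y hy => ?_) hx (hsum m x hx) hx
    · exact ((hg e).differentiable_iteratedFDeriv (m := m)
        (by exact_mod_cast WithTop.coe_lt_top m) y).hasFDerivAt
    · rw [norm_fderiv_iteratedFDeriv]
      exact h _ e y hy
  constructor
  · intro x hx
    change (∑' e, iteratedFDeriv ℝ 0 (g e) x) _ = _
    rw [ContinuousMultilinearMap.tsum_eval (hsum 0 x hx)]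
    simp
  · exact fun m _ x hx => (hD m x hx).hasFDerivWithinAt
  · exact fun m _ x hx => (hD m x hx).continuousAt.continuousWithinAt

section Series

theorem blockDegree_nonneg {ι : Type} [LinearOrder ι] {a : ι → ℕ}
    (d : ∀ i, Fin (a i) → ℝ) (hd : ∀ i k, 0 < d i k) {m : ℕ} (c : Fin m → (i : ι) × Fin (a i))
    (l : ι) : 0 ≤ blockDegree d c l :=
  Finset.sum_nonneg fun t _ => by split_ifs; exacts [(hd _ _).le, le_rfl]

theorem homDim_pos {ι : Type} {a : ι → ℕ} (d : ∀ i, Fin (a i) → ℝ)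
    (ha : ∀ l, 0 < a l) (hd : ∀ i k, 0 < d i k) (l : ι) : 0 < homDim d l := by
  have : Nonempty (Fin (a l)) := ⟨⟨0, ha l⟩⟩
  exact Finset.sum_pos (fun k _ => hd l k) Finset.univ_nonempty

variable {𝕜 : Type} [RCLike 𝕜] {ι : Type} [Fintype ι] [LinearOrder ι] {a : ι → ℕ}
  (d : ∀ i, Fin (a i) → ℝ)

/-- A sum of smooth functions which obey the bounds of dilates at the scales `i e`, with weights
`w e`, satisfies the differential inequalities. -/
theorem diffIneq_of_hasSum {α : Type*} [Countable α] (ha : ∀ l, 0 < a l) (hd : ∀ i k, 0 < d i k)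
    {g : α → Space a → 𝕜} (hg : ∀ e, ContDiff ℝ ∞ (g e)) {w : α → ℝ} (hw : ∀ e, 0 ≤ w e)
    {i : α → ι → ℤ} {C W : ℕ → ℝ} (hC : ∀ m, 0 ≤ C m)
    (hbound : ∀ m (c : Fin m → (i : ι) × Fin (a i)) e x,
      ‖iteratedFDeriv ℝ m (g e) x (fun t => unitVec a (c t))‖ ≤
        C m * (w e * ∏ l, scaleWeight (homDim d l + blockDegree d c l) (i e l) (flagNorm d l x)))
    (hsum : ∀ m (c : Fin m → (i : ι) × Fin (a i)) (D : ι → ℝ), (∀ l, 0 < D l) →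
      ∀ F : Finset α, ∑ e ∈ F,
        w e * ∏ l, scaleWeight (homDim d l + blockDegree d c l) (i e l) (D l) ≤
          W m * ∏ l, D l ^ (-(homDim d l + blockDegree d c l)))
    {T : 𝓢(Space a, 𝕜) → 𝕜} (hT : ∀ φ : 𝓢(Space a, 𝕜), HasSum (fun e => ∫ x, g e x * φ x) (T φ)) :
    DiffIneq a d T (fun m => C m * W m) := by
  have hq : ∀ {m} (c : Fin m → (i : ι) × Fin (a i)) l, 0 < homDim d l + blockDegree d c l :=
    fun c l => add_pos_of_pos_of_nonneg (homDim_pos d ha hd l) (blockDegree_nonneg d hd c l)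
  set v : ∀ m, (Fin m → (i : ι) × Fin (a i)) → (ι → ℝ) → α → ℝ := fun m c D e =>
    C m * (w e * ∏ l, scaleWeight (homDim d l + blockDegree d c l) (i e l) (D l)) with hv
  have hv0 : ∀ m c D e, (∀ l, 0 < D l) → 0 ≤ v m c D e := fun m c D e hD =>
    mul_nonneg (hC m) (mul_nonneg (hw e)
      (Finset.prod_nonneg fun l _ => scaleWeight_nonneg _ _ (hD l).le))
  have hvF : ∀ m c D, (∀ l, 0 < D l) → ∀ F : Finset α, ∑ e ∈ F, v m c D e ≤
      C m * W m * ∏ l, D l ^ (-(homDim d l + blockDegree d c l)) := by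
    intro m c D hD F
    rw [hv, ← Finset.mul_sum, mul_assoc]
    exact mul_le_mul_of_nonneg_left (hsum m c D hD F) (hC m)
  have hvs : ∀ m c D, (∀ l, 0 < D l) → Summable (v m c D) := fun m c D hD =>
    summable_of_sum_le (fun e => hv0 m c D e hD) (hvF m c D hD)
  have hvanti : ∀ m c D D' e, (∀ l, 0 < D l) → (∀ l, D l ≤ D' l) → v m c D' e ≤ v m c D e := by
    intro m c D D' e hD h
    refine mul_le_mul_of_nonneg_left (mul_le_mul_of_nonneg_left ?_ (hw e)) (hC m)
    exact Finset.prod_le_prod (fun l _ => scaleWeight_nonneg _ _ ((hD l).le.trans (h l)))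
      fun l _ => scaleWeight_anti (hq c l).le _ (hD l).le (h l)
  have taylor : ∀ x₀ ∉ singularSet a, ∃ r > 0, Metric.ball x₀ r ⊆ (singularSet a)ᶜ ∧
      (∀ m, ∀ x ∈ Metric.ball x₀ r, Summable fun e => iteratedFDeriv ℝ m (g e) x) ∧
      HasFTaylorSeriesUpToOn ∞ (fun x => ∑' e, g e x)
        (fun x m => ∑' e, iteratedFDeriv ℝ m (g e) x) (Metric.ball x₀ r) := by
    intro x₀ hx₀
    -- On a small ball all distances are at least `δ`. The weights decrease in the distances, so
    -- their values at the constant distance `δ` give one summable majorant for the whole ball.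
    obtain ⟨r, hr, δ, hδ, h⟩ := exists_ball_le_flagNorm d x₀ hx₀
    have hu : ∀ m, Summable fun e => ∑ c, v m c (fun _ => δ) e := fun m =>
      summable_sum fun c _ => hvs m c _ fun _ => hδ
    have hb : ∀ m e, ∀ x ∈ Metric.ball x₀ r,
        ‖iteratedFDeriv ℝ m (g e) x‖ ≤ ∑ c, v m c (fun _ => δ) e := fun m e x hx =>
      (norm_multilinear_le_sum _).trans (Finset.sum_le_sum fun c _ =>
        (hbound m c e x).trans (hvanti m c _ _ e (fun _ => hδ) (h x hx).2))
    exact ⟨r, hr, fun x hx => (h x hx).1,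
      fun m x hx => (hu m).of_norm_bounded fun e => hb m e x hx,
      hasFTaylorSeriesUpToOn_tsum hg Metric.isOpen_ball (convex_ball _ _).isPreconnected hu hb⟩
  refine ⟨fun x => ∑' e, g e x, ?_, ?_, ?_⟩
  · intro x hx
    obtain ⟨r, hr, -, -, h⟩ := taylor x hx
    exact (h.contDiffOn.contDiffAt (Metric.ball_mem_nhds _ hr)).contDiffWithinAt
  · intro m c x hx
    obtain ⟨r, hr, -, hs, h⟩ := taylor x hx
    have hxr := Metric.mem_ball_self (x := x) hr
    have e1 := h.eq_iteratedFDerivWithin_of_uniqueDiffOn (m := m) (by exact_mod_cast le_top)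
      Metric.isOpen_ball.uniqueDiffOn hxr
    rw [← iteratedFDerivWithin_of_isOpen m Metric.isOpen_ball hxr, ← e1,
      ContinuousMultilinearMap.tsum_eval (hs m x hxr)]
    have hD : ∀ l, 0 < flagNorm d l x := flagNorm_pos d hx
    have hs' := hvs m c _ hD
    exact (tsum_of_norm_bounded hs'.hasSum (hbound m c · x)).trans
      (hs'.tsum_le_of_sum_le (hvF m c _ hD))
  · rintro φ ⟨δ, hδ, hφ⟩
    set c₀ : Fin 0 → (i : ι) × Fin (a i) := Fin.elim0
    set S := ∑' e, v 0 c₀ (fun _ => δ) e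
    have hsv := hvs 0 c₀ (fun _ => δ) fun _ => hδ
    -- Where `φ` does not vanish, the first block norm, hence every `flagNorm`, is at least `δ`. The
    -- resulting majorant is summable in `e` and integrable in `x`, which allows sum and integral to
    -- be exchanged.
    have hgφ : ∀ e x, ‖g e x * φ x‖ ≤ v 0 c₀ (fun _ => δ) e * ‖φ x‖ := by
      intro e x
      rw [norm_mul]
      by_cases h : φ x = 0
      · simp [h]
      · refine mul_le_mul_of_nonneg_right ?_ (norm_nonneg _)
        have h1 := (hbound 0 c₀ e x).trans (hvanti 0 c₀ (fun _ => δ) _ e (fun _ => hδ)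
          (le_flagNorm_of_isMin d (hφ x h)))
        simpa using h1
    have hcont : ∀ e, Continuous fun x => g e x * φ x := fun e =>
      (hg e).continuous.mul φ.continuous
    have hφi : MeasureTheory.Integrable fun x => ‖φ x‖ := φ.integrable.norm
    have hgi : ∀ e, MeasureTheory.Integrable fun x => g e x * φ x := fun e =>
      (hφi.const_mul (v 0 c₀ (fun _ => δ) e)).mono' (hcont e).aestronglyMeasurable
        (Filter.Eventually.of_forall (hgφ e))
    have hsx : ∀ x, Summable fun e => g e x * φ x := fun x =>
      (hsv.mul_right ‖φ x‖).of_norm_bounded fun e => hgφ e x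
    have htsum : ∀ x, (∑' e, g e x) * φ x = ∑' e, g e x * φ x := fun x => tsum_mul_right.symm
    have hnorm : Summable fun e => ∫ x, ‖g e x * φ x‖ := by
      refine (hsv.mul_right (∫ x, ‖φ x‖)).of_nonneg_of_le
        (fun e => MeasureTheory.integral_nonneg fun x => norm_nonneg _) fun e => ?_
      rw [← MeasureTheory.integral_const_mul]
      exact MeasureTheory.integral_mono (hgi e).norm (hφi.const_mul _) (hgφ e)
    constructor
    · simp_rw [htsum]
      refine (hφi.const_mul S).mono' ?_ (Filter.Eventually.of_forall fun x => ?_)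
      · refine aestronglyMeasurable_of_tendsto_ae (Filter.atTop : Filter (Finset α))
          (f := fun F x => ∑ e ∈ F, g e x * φ x)
          (fun F => (continuous_finsetSum F fun e _ => hcont e).aestronglyMeasurable)
          (Filter.Eventually.of_forall fun x => (hsx x).hasSum)
      · rw [← tsum_mul_right]
        exact tsum_of_norm_bounded (hsv.mul_right ‖φ x‖).hasSum (hgφ · x)
    · simp_rw [htsum]
      exact (hT φ).unique (MeasureTheory.hasSum_integral_of_summable_integral_norm hgi hnorm)

end Series

/-! ### Splitting the variables -/

section Split

variable {ι : Type} [Fintype ι] [LinearOrder ι] (a : ι → ℕ) (L : Finset ι)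

/-- Extension of a vector in the blocks of `L` by zero. -/
def embed : Space (fun i : L => a i) →L[ℝ] Space a :=
  LinearMap.toContinuousLinearMap
    { toFun := fun x => WithLp.toLp 2 fun p => if h : p.1 ∈ L then x ⟨⟨p.1, h⟩, p.2⟩ else 0
      map_add' := fun x y => by ext p; by_cases h : p.1 ∈ L <;> simp [h]
      map_smul' := fun s x => by ext p; by_cases h : p.1 ∈ L <;> simp [h] }

theorem embed_apply (x : Space (fun i : L => a i)) (p : (i : ι) × Fin (a i)) :
    embed a L x p = if h : p.1 ∈ L then x ⟨⟨p.1, h⟩, p.2⟩ else 0 := rfl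

/-- The point of `ℝ^N` with coordinates `x` in the blocks of `L` and `y` in the others. -/
def glue (x : Space (fun i : L => a i)) (y : Space (fun i : (Lᶜ : Finset ι) => a i)) : Space a :=
  embed a L x + embed a Lᶜ y

theorem glue_apply_of_mem (x : Space (fun i : L => a i))
    (y : Space (fun i : (Lᶜ : Finset ι) => a i)) (p : (i : ι) × Fin (a i)) (h : p.1 ∈ L) :
    glue a L x y p = x ⟨⟨p.1, h⟩, p.2⟩ := by
  simp [glue, embed_apply, h]

theorem glue_apply_of_mem_compl (x : Space (fun i : L => a i))
    (y : Space (fun i : (Lᶜ : Finset ι) => a i)) (p : (i : ι) × Fin (a i)) (h : p.1 ∈ Lᶜ) :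
    glue a L x y p = y ⟨⟨p.1, h⟩, p.2⟩ := by
  have h' := h
  rw [Finset.mem_compl] at h'
  simp [glue, embed_apply, h']

theorem restrict_glue_left (x : Space (fun i : L => a i))
    (y : Space (fun i : (Lᶜ : Finset ι) => a i)) : restrict a L (glue a L x y) = x := by
  ext ⟨⟨i, hi⟩, k⟩
  exact glue_apply_of_mem a L x y ⟨i, k⟩ hi

theorem restrict_glue_right (x : Space (fun i : L => a i))
    (y : Space (fun i : (Lᶜ : Finset ι) => a i)) : restrict a Lᶜ (glue a L x y) = y := by
  ext ⟨⟨i, hi⟩, k⟩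
  exact glue_apply_of_mem_compl a L x y ⟨i, k⟩ hi

theorem glue_restrict (z : Space a) : glue a L (restrict a L z) (restrict a Lᶜ z) = z := by
  ext p
  by_cases h : p.1 ∈ L
  · rw [glue_apply_of_mem a L _ _ p h]; rfl
  · rw [glue_apply_of_mem_compl a L _ _ p (Finset.mem_compl.2 h)]; rfl

theorem embed_unitVec (p : (i : L) × Fin (a i)) :
    embed a L (unitVec (fun i : L => a i) p) = unitVec a ⟨p.1, p.2⟩ := by
  obtain ⟨⟨i, hi⟩, k⟩ := p
  ext ⟨j, k'⟩
  rw [embed_apply]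
  by_cases hj : j ∈ L
  · simp only [hj, dite_true, unitVec, PiLp.single_apply]
    congr 1
    simp only [Sigma.mk.injEq, Subtype.mk.injEq]
  · have : j ≠ i := fun h => hj (h ▸ hi)
    simp [hj, this]

/-- Lebesgue measure is the product measure on coordinates, so only a regrouping of coordinates is
involved. -/
theorem measurePreserving_restrict :
    MeasureTheory.MeasurePreserving
      (fun z : Space a => (restrict a L z, restrict a Lᶜ z)) := by
  classical
  let q : (i : ι) × Fin (a i) → Prop := fun x => x.1 ∈ L
  let e₁ : {x : (i : ι) × Fin (a i) // x.1 ∈ L} ≃ (i : L) × Fin (a i) :=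
    Equiv.subtypeSigmaEquiv (fun i => Fin (a i)) (· ∈ L)
  let e₂ : {x : (i : ι) × Fin (a i) // ¬ x.1 ∈ L} ≃ (i : (Lᶜ : Finset ι)) × Fin (a i) :=
    (Equiv.subtypeEquivRight fun x => Finset.mem_compl.symm).trans
      (Equiv.subtypeSigmaEquiv (fun i => Fin (a i)) (· ∈ Lᶜ))
  have h0 := EuclideanSpace.volume_preserving_symm_measurableEquiv_toLp ((i : ι) × Fin (a i))
  have h1 := MeasureTheory.volume_preserving_piEquivPiSubtypeProd
    (fun _ : (i : ι) × Fin (a i) => ℝ) q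
  have h2 := (MeasureTheory.volume_measurePreserving_piCongrLeft (fun _ => ℝ) e₁).prod
    (MeasureTheory.volume_measurePreserving_piCongrLeft (fun _ => ℝ) e₂)
  have h3 := (PiLp.volume_preserving_toLp ((i : L) × Fin (a i))).prod
    (PiLp.volume_preserving_toLp ((i : (Lᶜ : Finset ι)) × Fin (a i)))
  have h := h3.comp (h2.comp (h1.comp h0))
  have e : (fun z : Space a => (restrict a L z, restrict a Lᶜ z)) =
      Prod.map (WithLp.toLp 2) (WithLp.toLp 2) ∘
        Prod.map (MeasurableEquiv.piCongrLeft (fun _ => ℝ) e₁)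
          (MeasurableEquiv.piCongrLeft (fun _ => ℝ) e₂) ∘
        MeasurableEquiv.piEquivPiSubtypeProd (fun _ => ℝ) q ∘
          (MeasurableEquiv.toLp 2 ((i : ι) × Fin (a i) → ℝ)).symm := by
    funext z
    refine Prod.ext ?_ ?_
    · ext p
      simp only [Function.comp_apply, Prod.map_fst, MeasurableEquiv.coe_piCongrLeft,
        Equiv.piCongrLeft_apply]
      rfl
    · ext p
      simp only [Function.comp_apply, Prod.map_snd, MeasurableEquiv.coe_piCongrLeft,
        Equiv.piCongrLeft_apply]
      rfl
  rw [e]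
  exact h

theorem integral_eq_integral_glue {E : Type*} [NormedAddCommGroup E] [NormedSpace ℝ E]
    {h : Space a → E} (hh : MeasureTheory.Integrable h) :
    ∫ z, h z = ∫ x, ∫ y, h (glue a L x y) := by
  have hP := measurePreserving_restrict a L
  have hemb : MeasurableEmbedding (fun z : Space a => (restrict a L z, restrict a Lᶜ z)) := by
    refine Continuous.measurableEmbedding (by fun_prop) fun z z' hz => ?_
    have h1 : restrict a L z = restrict a L z' := congrArg Prod.fst hz
    have h2 : restrict a Lᶜ z = restrict a Lᶜ z' := congrArg Prod.snd hz
    rw [← glue_restrict a L z, ← glue_restrict a L z', h1, h2]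
  set H : Space (fun i : L => a i) × Space (fun i : (Lᶜ : Finset ι) => a i) → E :=
    fun q => h (glue a L q.1 q.2)
  have hH : H ∘ (fun z : Space a => (restrict a L z, restrict a Lᶜ z)) = h := by
    funext z
    exact congrArg h (glue_restrict a L z)
  have h1 : MeasureTheory.Integrable H := (hP.integrable_comp_emb hemb).1 (hH.symm ▸ hh)
  calc ∫ z, h z = ∫ z, H (restrict a L z, restrict a Lᶜ z) := by rw [← hH]; rfl
    _ = ∫ q, H q := hP.integral_comp hemb H
    _ = _ := MeasureTheory.integral_prod H h1

end Split

/-! ### Partial integrals -/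

theorem lineDerivOp_comm {E F : Type*} [NormedAddCommGroup E] [NormedSpace ℝ E]
    [NormedAddCommGroup F] [NormedSpace ℝ F] (v w : E) (f : 𝓢(E, F)) :
    ∂_{v} (∂_{w} f) = ∂_{w} (∂_{v} f) := by
  ext x
  have key : ∀ v w : E, ∂_{v} (∂_{w} f) x = fderiv ℝ (fderiv ℝ f) x v w := by
    intro v w
    rw [SchwartzMap.lineDerivOp_apply_eq_fderiv]
    have h1 : ((∂_{w} f : 𝓢(E, F)) : E → F) = fun y => fderiv ℝ f y w := by
      funext y; exact SchwartzMap.lineDerivOp_apply_eq_fderiv _ _ _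
    have h2 : DifferentiableAt ℝ (fderiv ℝ f) x :=
      ((f.smooth 2).fderiv_right (m := 1) (by norm_num)).differentiable (by norm_num) x
    rw [h1, fderiv_clm_apply h2 (differentiableAt_const w)]
    simp
  rw [key, key]
  exact ((f.smooth 2).contDiffAt.isSymmSndFDerivAt (by simp)) v w

section PartialIntegral

variable {𝕜 : Type} [RCLike 𝕜] {ι : Type} [Fintype ι] [LinearOrder ι] {a : ι → ℕ} {L : Finset ι}

theorem hasFDerivAt_glue_left (y : Space (fun i : (Lᶜ : Finset ι) => a i))
    (x : Space (fun i : L => a i)) : HasFDerivAt (fun x => glue a L x y) (embed a L) x :=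
  (embed a L).hasFDerivAt.add_const _

theorem hasFDerivAt_glue_right (x : Space (fun i : L => a i))
    (y : Space (fun i : (Lᶜ : Finset ι) => a i)) :
    HasFDerivAt (fun y => glue a L x y) (embed a Lᶜ) y :=
  (embed a Lᶜ).hasFDerivAt.const_add _

theorem continuous_glue_right (x : Space (fun i : L => a i)) :
    Continuous fun y => glue a L x y := by
  unfold glue; fun_prop

theorem integrable_glue_mul (f : 𝓢(Space a, 𝕜))
    (χ : 𝓢(Space (fun i : (Lᶜ : Finset ι) => a i), 𝕜)) (x : Space (fun i : L => a i)) :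
    MeasureTheory.Integrable fun y => f (glue a L x y) * χ y := by
  exact χ.integrable.bdd_mul (f.continuous.comp (continuous_glue_right x)).aestronglyMeasurable
    (Filter.Eventually.of_forall fun y => f.norm_le_seminorm ℝ _)

/-- The partial integral `∫ f(x, y) χ(y) dy` over the blocks outside `L`. -/
def partialIntegral (f : 𝓢(Space a, 𝕜)) (χ : 𝓢(Space (fun i : (Lᶜ : Finset ι) => a i), 𝕜))
    (x : Space (fun i : L => a i)) : 𝕜 :=
  ∫ y, f (glue a L x y) * χ y

variable (χ : 𝓢(Space (fun i : (Lᶜ : Finset ι) => a i), 𝕜))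

theorem partialIntegral_sum {α : Type*} (s : Finset α) (f : α → 𝓢(Space a, 𝕜))
    (x : Space (fun i : L => a i)) :
    partialIntegral (∑ e ∈ s, f e) χ x = ∑ e ∈ s, partialIntegral (f e) χ x := by
  unfold partialIntegral
  rw [← MeasureTheory.integral_finsetSum _ fun e _ => integrable_glue_mul (f e) χ x]
  simp [Finset.sum_mul]

theorem partialIntegral_smul_left (r : ℝ) (f : 𝓢(Space a, 𝕜)) (x : Space (fun i : L => a i)) :
    partialIntegral (r • f) χ x = r • partialIntegral f χ x := by
  unfold partialIntegral
  rw [← MeasureTheory.integral_smul]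
  simp

theorem partialIntegral_smul_right (r : ℝ) (f : 𝓢(Space a, 𝕜)) (x : Space (fun i : L => a i)) :
    partialIntegral f (r • χ) x = r • partialIntegral f χ x := by
  unfold partialIntegral
  rw [← MeasureTheory.integral_smul]
  simp

/-- Differentiation under the integral sign: the derivative of `f` is bounded and `χ` is integrable,
which gives a dominating function independent of `x`. -/
theorem exists_hasFDerivAt_partialIntegral (f : 𝓢(Space a, 𝕜)) (x : Space (fun i : L => a i)) :
    ∃ f' : Space (fun i : L => a i) →L[ℝ] 𝕜, HasFDerivAt (partialIntegral f χ) f' x ∧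
      ∀ v, f' v = partialIntegral (∂_{embed a L v} f) χ x := by
  obtain ⟨C, -, hC⟩ := f.decay 0 1
  have hC' : ∀ z, ‖fderiv ℝ f z‖ ≤ C := fun z => by
    simpa [norm_iteratedFDeriv_one] using hC z
  have hcont : Continuous (fderiv ℝ f) := (f.smooth 1).continuous_fderiv (by norm_num)
  have hmeas : MeasureTheory.AEStronglyMeasurable
      (fun y => χ y • (fderiv ℝ f (glue a L x y)).comp (embed a L)) := by
    refine Continuous.aestronglyMeasurable ?_
    have := hcont.comp (continuous_glue_right (a := a) (L := L) x)
    exact χ.continuous.smul (this.clm_comp continuous_const)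
  have hbd : ∀ y x', ‖χ y • (fderiv ℝ f (glue a L x' y)).comp (embed a L)‖ ≤
      ‖χ y‖ * (C * ‖embed a L‖) := by
    intro y x'
    rw [norm_smul]
    gcongr
    exact (ContinuousLinearMap.opNorm_comp_le _ _).trans (by gcongr; exact hC' _)
  have hint : MeasureTheory.Integrable fun y => ‖χ y‖ * (C * ‖embed a L‖) :=
    χ.integrable.norm.mul_const _
  refine ⟨_, hasFDerivAt_integral_of_dominated_of_fderiv_le
    (F' := fun x y => χ y • (fderiv ℝ f (glue a L x y)).comp (embed a L)) Filter.univ_mem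
    (Filter.Eventually.of_forall fun x => (integrable_glue_mul f χ x).aestronglyMeasurable)
    (integrable_glue_mul f χ x) hmeas
    (Filter.Eventually.of_forall fun y x' _ => hbd y x') hint
    (Filter.Eventually.of_forall fun y x' _ => ?_), fun v => ?_⟩
  · have h1 := (f.differentiableAt (x := glue a L x' y)).hasFDerivAt.comp x'
      (hasFDerivAt_glue_left y x')
    exact h1.mul_const (χ y)
  · have h2 : MeasureTheory.Integrable
        (fun y => χ y • (fderiv ℝ f (glue a L x y)).comp (embed a L)) :=
      hint.mono' hmeas (Filter.Eventually.of_forall fun y => hbd y x)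
    rw [ContinuousLinearMap.integral_apply h2]
    refine MeasureTheory.integral_congr_ae (Filter.Eventually.of_forall fun y => ?_)
    change χ y * fderiv ℝ f (glue a L x y) (embed a L v) = _
    rw [mul_comm, ← SchwartzMap.lineDerivOp_apply_eq_fderiv]

theorem contDiff_partialIntegral (f : 𝓢(Space a, 𝕜)) :
    ContDiff ℝ ∞ (partialIntegral f χ) := by
  rw [contDiff_infty]
  intro m
  induction m generalizing f with
  | zero =>
    refine contDiff_zero.2 (continuous_iff_continuousAt.2 fun x => ?_)
    obtain ⟨f', hf', -⟩ := exists_hasFDerivAt_partialIntegral χ f x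
    exact hf'.continuousAt
  | succ m ih =>
    -- The derivative is written in coordinates, each coefficient being again the partial integral
    -- of a Schwartz function. This closes the induction over `f`.
    refine contDiff_succ_iff_hasFDerivAt.2 ⟨fun x => ∑ p,
      (EuclideanSpace.proj p : Space (fun i : L => a i) →L[ℝ] ℝ).smulRight
        (partialIntegral (∂_{embed a L (unitVec (fun i : L => a i) p)} f) χ x), ?_, fun x => ?_⟩
    · exact ContDiff.sum fun p _ => contDiff_const.smulRight (ih _)
    · obtain ⟨f', hf', h⟩ := exists_hasFDerivAt_partialIntegral χ f x
      have e : ∑ p, (EuclideanSpace.proj p : Space (fun i : L => a i) →L[ℝ] ℝ).smulRight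
          (partialIntegral (∂_{embed a L (unitVec (fun i : L => a i) p)} f) χ x) = f' := by
        ext v
        have hv : v = ∑ p, v p • unitVec (fun i : L => a i) p := by
          ext p
          simp [Pi.single_apply]
        conv_rhs => rw [hv, map_sum]
        simp only [sum_apply, ContinuousLinearMap.smulRight_apply, PiLp.proj_apply]
        exact Finset.sum_congr rfl fun p _ => by rw [map_smul f', h]
      rw [← e] at hf'
      exact hf'

theorem iteratedFDeriv_partialIntegral (f : 𝓢(Space a, 𝕜)) {m : ℕ}
    (v : Fin m → Space (fun i : L => a i)) (x : Space (fun i : L => a i)) :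
    iteratedFDeriv ℝ m (partialIntegral f χ) x v
      = partialIntegral (∂^{fun t => embed a L (v t)} f) χ x := by
  induction m generalizing f with
  | zero => simp
  | succ m ih =>
    have h1 : ∀ u, (fun y => fderiv ℝ (partialIntegral f χ) y u)
        = partialIntegral (∂_{embed a L u} f) χ := by
      intro u
      funext y
      obtain ⟨f', hf', h⟩ := exists_hasFDerivAt_partialIntegral χ f y
      rw [hf'.fderiv, h]
    have h2 : ContDiff ℝ ∞ (fderiv ℝ (partialIntegral f χ)) :=
      (contDiff_partialIntegral χ f).fderiv_right (by simp)
    rw [iteratedFDeriv_succ_apply_right,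
      ← iteratedFDeriv_clm_apply_const_apply h2 (by exact_mod_cast le_top), h1, ih,
      LineDeriv.iteratedLineDerivOp_succ_right]
    rfl

/-- Integration by parts in a variable outside `L`; integrability of the three products removes the
boundary terms. -/
theorem partialIntegral_lineDerivOp (f : 𝓢(Space a, 𝕜))
    (v : Space (fun i : (Lᶜ : Finset ι) => a i)) (x : Space (fun i : L => a i)) :
    partialIntegral (∂_{embed a Lᶜ v} f) χ x = -partialIntegral f (∂_{v} χ) x := by
  have hf : ∀ y, HasFDerivAt (fun y => f (glue a L x y))
      ((fderiv ℝ f (glue a L x y)).comp (embed a Lᶜ)) y := fun y =>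
    (f.differentiableAt (x := glue a L x y)).hasFDerivAt.comp y (hasFDerivAt_glue_right x y)
  have e1 : ∀ y, (∂_{embed a Lᶜ v} f) (glue a L x y)
      = fderiv ℝ (fun y => f (glue a L x y)) y v := fun y => by
    rw [(hf y).fderiv, SchwartzMap.lineDerivOp_apply_eq_fderiv]; rfl
  have e2 : ∀ y, (∂_{v} χ) y = fderiv ℝ χ y v := fun y =>
    SchwartzMap.lineDerivOp_apply_eq_fderiv _ _ _
  unfold partialIntegral
  have h1 := integrable_glue_mul (∂_{embed a Lᶜ v} f) χ x
  have h2 := integrable_glue_mul f (∂_{v} χ) x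
  simp_rw [e1] at h1 ⊢
  simp_rw [e2] at h2 ⊢
  rw [integral_mul_fderiv_eq_neg_fderiv_mul_of_integrable h1 h2 (integrable_glue_mul f χ x)
    (fun y _ => (hf y).differentiableAt) (fun y _ => χ.differentiableAt), neg_neg]

theorem integral_mul_eq_integral_partialIntegral (f : 𝓢(Space a, 𝕜))
    (φ : Space (fun i : L => a i) → 𝕜)
    (h : MeasureTheory.Integrable fun z => f z * (χ (restrict a Lᶜ z) * φ (restrict a L z))) :
    ∫ z, f z * (χ (restrict a Lᶜ z) * φ (restrict a L z)) = ∫ x, partialIntegral f χ x * φ x := by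
  rw [integral_eq_integral_glue a L h]
  refine MeasureTheory.integral_congr_ae (Filter.Eventually.of_forall fun x => ?_)
  simp only [partialIntegral]
  rw [← MeasureTheory.integral_mul_const]
  refine MeasureTheory.integral_congr_ae (Filter.Eventually.of_forall fun y => ?_)
  simp only [restrict_glue_left, restrict_glue_right]
  ring

end PartialIntegral

/-! ### Iterated partial derivatives of Schwartz functions and of their dilates -/

section Derivatives

variable {𝕜 : Type} [RCLike 𝕜] {ι : Type} [Fintype ι] {a : ι → ℕ}

theorem seminorm_le_schwartzNorm {k l M : ℕ} (h : k + l ≤ M) (f : 𝓢(Space a, 𝕜)) :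
    SchwartzMap.seminorm 𝕜 k l f ≤ schwartzNorm M f := by
  have hm : (k, l) ∈ (Finset.range (M + 1) ×ˢ Finset.range (M + 1)).filter
      (fun q => q.1 + q.2 ≤ M) := by
    simp only [Finset.mem_filter, Finset.mem_product, Finset.mem_range]; omega
  exact Seminorm.le_def.1 (Finset.le_sup (f := schwartzSeminormFamily 𝕜 (Space a) 𝕜) hm) f

theorem schwartzNorm_nonneg (M : ℕ) (f : 𝓢(Space a, 𝕜)) : 0 ≤ schwartzNorm M f :=
  apply_nonneg _ _

section Dilate

variable (d : ∀ i, Fin (a i) → ℝ) (r : ι → ℝ) (hr : ∀ i, 0 < r i)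

/-- The dilate `x ↦ f (r · x)`. -/
def dilate (f : 𝓢(Space a, 𝕜)) : 𝓢(Space a, 𝕜) :=
  SchwartzMap.compCLMOfContinuousLinearEquiv 𝕜 (dilation d r hr) f

theorem dilation_apply (x : Space a) (p : (i : ι) × Fin (a i)) :
    dilation d r hr x p = r p.1 ^ d p.1 p.2 * x p := rfl

theorem dilate_apply (f : 𝓢(Space a, 𝕜)) (x : Space a) :
    dilate d r hr f x = f (dilation d r hr x) := rfl

end Dilate

variable [LinearOrder ι]

/-- The iterated derivative of `f` in the coordinates `l`. -/
def derivList (l : List ((i : ι) × Fin (a i))) (f : 𝓢(Space a, 𝕜)) : 𝓢(Space a, 𝕜) :=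
  l.foldr (fun p g => ∂_{unitVec a p} g) f

theorem derivList_cons (p : (i : ι) × Fin (a i)) (l : List ((i : ι) × Fin (a i)))
    (f : 𝓢(Space a, 𝕜)) : derivList (p :: l) f = ∂_{unitVec a p} (derivList l f) := rfl

theorem derivList_singleton (p : (i : ι) × Fin (a i)) (f : 𝓢(Space a, 𝕜)) :
    derivList [p] f = ∂_{unitVec a p} f := rfl

theorem derivList_append (l l' : List ((i : ι) × Fin (a i))) (f : 𝓢(Space a, 𝕜)) :
    derivList (l ++ l') f = derivList l (derivList l' f) := List.foldr_append

theorem derivList_lineDerivOp (l : List ((i : ι) × Fin (a i))) (p : (i : ι) × Fin (a i))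
    (f : 𝓢(Space a, 𝕜)) : derivList l (∂_{unitVec a p} f) = ∂_{unitVec a p} (derivList l f) := by
  induction l with
  | nil => rfl
  | cons q l ih => rw [derivList_cons, derivList_cons, ih, lineDerivOp_comm]

theorem derivList_smul (l : List ((i : ι) × Fin (a i))) (r : ℝ) (f : 𝓢(Space a, 𝕜)) :
    derivList l (r • f) = r • derivList l f := by
  induction l with
  | nil => rfl
  | cons q l ih => rw [derivList_cons, derivList_cons, ih, LineDeriv.lineDerivOp_smul]

theorem derivList_sum {α : Type*} (l : List ((i : ι) × Fin (a i))) (s : Finset α)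
    (f : α → 𝓢(Space a, 𝕜)) : derivList l (∑ e ∈ s, f e) = ∑ e ∈ s, derivList l (f e) := by
  induction l with
  | nil => rfl
  | cons q l ih => simp only [derivList_cons, ih, LineDeriv.lineDerivOp_sum]

theorem iteratedLineDerivOp_eq_derivList {m : ℕ} (c : Fin m → (i : ι) × Fin (a i))
    (f : 𝓢(Space a, 𝕜)) : ∂^{fun t => unitVec a (c t)} f = derivList (List.ofFn c) f := by
  induction m with
  | zero => simp [derivList]
  | succ m ih =>
    rw [LineDeriv.iteratedLineDerivOp_succ_left, List.ofFn_succ, derivList_cons, ← ih]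
    rfl

theorem norm_derivList_le (K : ℕ) {m M : ℕ} (l : List ((i : ι) × Fin (a i))) (hl : l.length ≤ m)
    (hM : K + m ≤ M) (f : 𝓢(Space a, 𝕜)) (u : Space a) :
    ‖derivList l f u‖ ≤ 2 ^ (K + 1) * schwartzNorm M f * ((1 + ‖u‖) ^ K)⁻¹ := by
  have h0 : ‖derivList l f u‖ ≤ ‖iteratedFDeriv ℝ l.length f u‖ := by
    rw [← List.ofFn_get l, ← iteratedLineDerivOp_eq_derivList,
      SchwartzMap.iteratedLineDerivOp_eq_iteratedFDeriv, List.ofFn_get]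
    refine (ContinuousMultilinearMap.le_opNorm _ _).trans (le_of_eq ?_)
    simp
  rw [← div_eq_mul_inv, le_div_iff₀ (by positivity)]
  have h1 : (1 + ‖u‖) ^ K ≤ 2 ^ K * (1 + ‖u‖ ^ K) := by
    refine (add_pow_le zero_le_one (norm_nonneg u) K).trans ?_
    rw [one_pow]
    gcongr
    · norm_num
    · omega
  have h2 := (SchwartzMap.le_seminorm 𝕜 0 l.length f u).trans
    (seminorm_le_schwartzNorm (M := M) (by omega) f)
  have h3 := (SchwartzMap.le_seminorm 𝕜 K l.length f u).trans
    (seminorm_le_schwartzNorm (M := M) (by omega) f)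
  rw [pow_zero, one_mul] at h2
  calc ‖derivList l f u‖ * (1 + ‖u‖) ^ K
      ≤ ‖iteratedFDeriv ℝ l.length f u‖ * (2 ^ K * (1 + ‖u‖ ^ K)) := by gcongr
    _ = 2 ^ K * (‖iteratedFDeriv ℝ l.length f u‖ + ‖u‖ ^ K * ‖iteratedFDeriv ℝ l.length f u‖) := by
        ring
    _ ≤ 2 ^ K * (schwartzNorm M f + schwartzNorm M f) := by gcongr
    _ = _ := by ring

variable (d : ∀ i, Fin (a i) → ℝ) (r : ι → ℝ) (hr : ∀ i, 0 < r i)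

theorem dilation_unitVec (p : (i : ι) × Fin (a i)) :
    dilation d r hr (unitVec a p) = r p.1 ^ d p.1 p.2 • unitVec a p := by
  ext q
  rw [dilation_apply]
  by_cases h : q = p
  · subst h; simp
  · simp [h]

theorem lineDerivOp_dilate (p : (i : ι) × Fin (a i)) (f : 𝓢(Space a, 𝕜)) :
    ∂_{unitVec a p} (dilate d r hr f) = r p.1 ^ d p.1 p.2 • dilate d r hr (∂_{unitVec a p} f) := by
  unfold dilate
  rw [SchwartzMap.lineDerivOp_compCLMOfContinuousLinearEquiv, dilation_unitVec,
    LineDeriv.lineDerivOp_left_smul]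
  ext x
  simp

theorem dilate_lineDerivOp (p : (i : ι) × Fin (a i)) (f : 𝓢(Space a, 𝕜)) :
    dilate d r hr (∂_{unitVec a p} f)
      = (r p.1 ^ d p.1 p.2)⁻¹ • ∂_{unitVec a p} (dilate d r hr f) := by
  rw [lineDerivOp_dilate, smul_smul, inv_mul_cancel₀, one_smul]
  exact (Real.rpow_pos_of_pos (hr _) _).ne'

theorem derivList_ofFn_dilate {m : ℕ} (c : Fin m → (i : ι) × Fin (a i)) (f : 𝓢(Space a, 𝕜)) :
    derivList (List.ofFn c) (dilate d r hr f)
      = (∏ l, r l ^ blockDegree d c l) • dilate d r hr (derivList (List.ofFn c) f) := by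
  have h1 : ∀ l : List ((i : ι) × Fin (a i)), derivList l (dilate d r hr f)
      = (l.map fun p => r p.1 ^ d p.1 p.2).prod • dilate d r hr (derivList l f) := by
    intro l
    induction l with
    | nil => simp [derivList]
    | cons q l ih =>
      rw [derivList_cons, derivList_cons, ih, LineDeriv.lineDerivOp_smul, lineDerivOp_dilate,
        smul_smul, List.map_cons, List.prod_cons, mul_comm]
  rw [h1]
  congr 1
  rw [List.map_ofFn, List.prod_ofFn]
  have h2 : ∀ l, r l ^ blockDegree d c l =
      ∏ t, r l ^ (if (c t).1 = l then d (c t).1 (c t).2 else 0) :=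
    fun l => Real.rpow_sum_of_pos (hr l) _ _
  simp_rw [h2]
  rw [Finset.prod_comm]
  refine Finset.prod_congr rfl fun t _ => ?_
  rw [Finset.prod_eq_single (c t).1]
  · simp
  · intro l _ hl
    simp [hl.symm]
  · simp

end Derivatives

/-! ### Decay of dilates in terms of the scale weights -/

theorem dyadic_pos {ι : Type} (i : ι → ℤ) (l : ι) : (0 : ℝ) < 2 ^ (-i l) := by positivity

section Decay

variable {ι : Type} [Fintype ι] {a : ι → ℕ} (d : ∀ i, Fin (a i) → ℝ)

theorem exists_blockNorm_le (hd : ∀ i k, 0 < d i k) :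
    ∃ E : ℝ, 0 ≤ E ∧ ∀ i (x : Space a), blockNorm d i x ≤ (1 + ‖x‖) ^ E := by
  refine ⟨∑ p : (i : ι) × Fin (a i), 1 / d p.1 p.2,
    Finset.sum_nonneg fun p _ => (one_div_pos.2 (hd _ _)).le, fun i x => ?_⟩
  refine Real.iSup_le (fun k => ?_) (by positivity)
  have h1 : 1 / d i k ≤ ∑ p : (i : ι) × Fin (a i), 1 / d p.1 p.2 :=
    Finset.single_le_sum (f := fun p : (i : ι) × Fin (a i) => 1 / d p.1 p.2)
      (fun p _ => (one_div_pos.2 (hd _ _)).le) (Finset.mem_univ ⟨i, k⟩)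
  have h2 : |x ⟨i, k⟩| ≤ 1 + ‖x‖ := by
    have := PiLp.norm_apply_le x ⟨i, k⟩
    rw [Real.norm_eq_abs] at this
    linarith
  exact (Real.rpow_le_rpow (abs_nonneg _) h2 (one_div_pos.2 (hd _ _)).le).trans
    (Real.rpow_le_rpow_of_exponent_le (by linarith [norm_nonneg x]) h1)

theorem blockNorm_dilation (hd : ∀ i k, 0 < d i k) (r : ι → ℝ) (hr : ∀ i, 0 < r i) (i : ι)
    (x : Space a) : blockNorm d i (dilation d r hr x) = r i * blockNorm d i x := by
  unfold blockNorm
  rw [Real.mul_iSup_of_nonneg (hr i).le]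
  congr 1
  funext k
  have h := Real.rpow_pos_of_pos (hr i) (d i k)
  rw [dilation_apply, abs_mul, abs_of_pos h, Real.mul_rpow h.le (abs_nonneg _),
    ← Real.rpow_mul (hr i).le, mul_one_div_cancel (hd i k).ne', Real.rpow_one]

variable [LinearOrder ι]

/-- With `u = 2^{-I} · x` and `j ≤ l`, monotonicity gives `2^{-i_l} N_j(x) ≤ 2^{-i_j} N_j(x) =
N_j(u)`, and `N_j(u)` is at most a power of `1 + ‖u‖`. Decay in `‖u‖` thus yields decay in
`2^{-i_l}` times the whole flag norm. -/
theorem exists_decay_le_scaleWeight (ha : ∀ l, 0 < a l) (hd : ∀ i k, 0 < d i k) (m : ℕ) :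
    ∃ (K : ℕ) (C : ℝ), 0 ≤ C ∧ ∀ (c : Fin m → (i : ι) × Fin (a i)) (i : ι → ℤ), Monotone i →
      ∀ x : Space a, (∏ l, ((2 : ℝ) ^ (-i l)) ^ (homDim d l + blockDegree d c l)) *
        ((1 + ‖dilation d (fun l => (2 : ℝ) ^ (-i l)) (dyadic_pos i) x‖) ^ K)⁻¹ ≤
          C * ∏ l, scaleWeight (homDim d l + blockDegree d c l) (i l) (flagNorm d l x) := by
  obtain ⟨E, hE, hN⟩ := exists_blockNorm_le d hd
  set q : (Fin m → (i : ι) × Fin (a i)) → ι → ℝ := fun c l => homDim d l + blockDegree d c l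
  have hq : ∀ c l, 0 < q c l :=
    fun c l => add_pos_of_pos_of_nonneg (homDim_pos d ha hd l) (blockDegree_nonneg d hd c l)
  set Γ : (Fin m → (i : ι) × Fin (a i)) → ℝ := fun c => ∑ l, (q c l + 1)
  have hΓ : ∀ c, 0 ≤ Γ c := fun c => Finset.sum_nonneg fun l _ => by linarith [hq c l]
  have hΓ' : ∀ c, Γ c ≤ ∑ c, Γ c := fun c =>
    Finset.single_le_sum (fun c _ => hΓ c) (Finset.mem_univ c)
  set n : ℝ := 1 + Fintype.card ι
  have hn : 1 ≤ n := by simp [n]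
  -- `Γ c` is the total exponent needed for the derivative `c`. Summing over the finitely many `c`
  -- of length `m` makes both constants independent of `c`.
  refine ⟨⌈E * ∑ c, Γ c⌉₊, n ^ (∑ c, Γ c), by positivity, fun c i hi x => ?_⟩
  set u := dilation d (fun l => (2 : ℝ) ^ (-i l)) (dyadic_pos i) x with hu
  have hu1 : 1 ≤ 1 + ‖u‖ := by linarith [norm_nonneg u]
  have h1 : ∀ l, 1 + (2 : ℝ) ^ (-(i l : ℝ)) * flagNorm d l x ≤ n * (1 + ‖u‖) ^ E := by
    intro l
    have h2 : (2 : ℝ) ^ (-(i l : ℝ)) * flagNorm d l x ≤ Fintype.card ι * (1 + ‖u‖) ^ E := by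
      rw [flagNorm, Finset.mul_sum]
      refine (Finset.sum_le_sum (g := fun _ => (1 + ‖u‖) ^ E) fun j hj => ?_).trans ?_
      · refine le_trans ?_ (hN j u)
        rw [hu, blockNorm_dilation d hd]
        refine mul_le_mul_of_nonneg_right ?_ (blockNorm_nonneg d j x)
        rw [← Real.rpow_intCast]
        apply Real.rpow_le_rpow_of_exponent_le (by norm_num)
        have : (i j : ℝ) ≤ i l := by exact_mod_cast hi (by simpa using hj)
        push_cast
        linarith
      · rw [Finset.sum_const, nsmul_eq_mul]
        gcongr
        exact Finset.card_le_univ _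
    have h3 : 1 ≤ (1 + ‖u‖) ^ E := Real.one_le_rpow hu1 hE
    simp only [n]
    linarith
  have h4 : ∏ l, (1 + (2 : ℝ) ^ (-(i l : ℝ)) * flagNorm d l x) ^ (q c l + 1) ≤
      n ^ (∑ c, Γ c) * (1 + ‖u‖) ^ ⌈E * ∑ c, Γ c⌉₊ := by
    calc _ ≤ ∏ l, (n * (1 + ‖u‖) ^ E) ^ (q c l + 1) := by
          refine Finset.prod_le_prod (fun l _ => ?_) fun l _ => ?_
          · have := flagNorm_nonneg d l x
            positivity
          · refine Real.rpow_le_rpow ?_ (h1 l) (by linarith [hq c l])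
            have := flagNorm_nonneg d l x
            positivity
      _ = (n * (1 + ‖u‖) ^ E) ^ Γ c := (Real.rpow_sum_of_pos (by positivity) _ _).symm
      _ = n ^ Γ c * (1 + ‖u‖) ^ (E * Γ c) := by
          rw [Real.mul_rpow (by linarith) (by positivity), ← Real.rpow_mul (by linarith)]
      _ ≤ _ := by
          rw [← Real.rpow_natCast]
          gcongr
          · exact hΓ' c
          · exact (mul_le_mul_of_nonneg_left (hΓ' c) hE).trans (Nat.le_ceil _)
  have h5 : ∏ l, scaleWeight (q c l) (i l) (flagNorm d l x) =
      (∏ l, ((2 : ℝ) ^ (-i l)) ^ (q c l)) *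
        (∏ l, (1 + (2 : ℝ) ^ (-(i l : ℝ)) * flagNorm d l x) ^ (q c l + 1))⁻¹ := by
    rw [← Finset.prod_inv_distrib, ← Finset.prod_mul_distrib]
    refine Finset.prod_congr rfl fun l _ => ?_
    have := flagNorm_nonneg d l x
    rw [scaleWeight, Real.rpow_neg (by positivity)]
    congr 1
    rw [← Real.rpow_intCast, ← Real.rpow_mul (by norm_num)]
    congr 1
    push_cast
    ring
  change (∏ l, ((2 : ℝ) ^ (-i l)) ^ (q c l)) * _ ≤ _ * ∏ l, scaleWeight (q c l) (i l) _
  rw [h5, mul_left_comm]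
  refine mul_le_mul_of_nonneg_left ?_ (by positivity)
  have hpos : 0 < ∏ l, (1 + (2 : ℝ) ^ (-(i l : ℝ)) * flagNorm d l x) ^ (q c l + 1) :=
    Finset.prod_pos fun l _ => by
      have := flagNorm_nonneg d l x
      positivity
  rw [← div_eq_mul_inv, le_div_iff₀ hpos, inv_mul_le_iff₀ (by positivity), mul_comm]
  exact h4

end Decay

/-! ### Estimates for partial integrals of dilates -/

section ProductIntegral

variable {κ : Type} [Fintype κ]

theorem integrable_inv_one_add_mul_sq {m : ℝ} (hm : 0 < m) :
    MeasureTheory.Integrable fun x : ℝ => (1 + (m * x) ^ 2)⁻¹ :=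
  integrable_inv_one_add_sq.comp_mul_left' hm.ne'

theorem integrable_prod_inv_one_add_mul_sq {m : κ → ℝ} (hm : ∀ p, 0 < m p) :
    MeasureTheory.Integrable fun y : EuclideanSpace ℝ κ => ∏ p, (1 + (m p * y p) ^ 2)⁻¹ := by
  have h : MeasureTheory.Integrable fun y : κ → ℝ => ∏ p, (1 + (m p * y p) ^ 2)⁻¹ :=
    MeasureTheory.Integrable.fintype_prod (f := fun p (x : ℝ) => (1 + (m p * x) ^ 2)⁻¹)
      fun p => integrable_inv_one_add_mul_sq (hm p)
  exact ((PiLp.volume_preserving_ofLp κ).integrable_comp_emb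
    (MeasurableEquiv.toLp 2 (κ → ℝ)).symm.measurableEmbedding).2 h

theorem integral_prod_inv_one_add_mul_sq {m : κ → ℝ} (hm : ∀ p, 0 < m p) :
    ∫ y : EuclideanSpace ℝ κ, ∏ p, (1 + (m p * y p) ^ 2)⁻¹ = ∏ p, Real.pi / m p := by
  have h := (PiLp.volume_preserving_ofLp κ).integral_comp
    (MeasurableEquiv.toLp 2 (κ → ℝ)).symm.measurableEmbedding
    (fun y : κ → ℝ => ∏ p, (1 + (m p * y p) ^ 2)⁻¹)
  rw [h, MeasureTheory.integral_fintype_prod_volume_eq_prod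
    (f := fun p (x : ℝ) => (1 + (m p * x) ^ 2)⁻¹)]
  refine Finset.prod_congr rfl fun p _ => ?_
  rw [MeasureTheory.Measure.integral_comp_mul_left (fun x : ℝ => (1 + x ^ 2)⁻¹),
    integral_univ_inv_one_add_sq, abs_of_pos (inv_pos.2 (hm p)), smul_eq_mul, inv_mul_eq_div]

end ProductIntegral

theorem norm_restrict_le {ι : Type} [Fintype ι] (a : ι → ℕ) (L : Finset ι) (x : Space a) :
    ‖restrict a L x‖ ≤ ‖x‖ := by
  refine le_of_sq_le_sq ?_ (norm_nonneg _)
  rw [EuclideanSpace.norm_sq_eq, EuclideanSpace.norm_sq_eq, Fintype.sum_sigma, Fintype.sum_sigma]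
  exact (Finset.sum_coe_sort L (fun i => ∑ k : Fin (a i), ‖x ⟨i, k⟩‖ ^ 2)).le.trans
    (Finset.sum_le_univ_sum_of_nonneg fun i => by positivity)

section Estimates

variable {𝕜 : Type} [RCLike 𝕜] {ι : Type} [Fintype ι] [LinearOrder ι] {a : ι → ℕ} {L : Finset ι}
  (d : ∀ i, Fin (a i) → ℝ) {r : ι → ℝ} (hr : ∀ i, 0 < r i) {R : ι → ℝ} (hR : ∀ i, 0 < R i)

/-- In each integrated coordinate the decay of the more concentrated of the two dilates is used,
whence the maximum of the two dilation factors. The remaining decay of `g` bounds the dependence on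
`x`. -/
theorem norm_partialIntegral_dilate_le (K : ℕ) (g : 𝓢(Space a, 𝕜))
    (h : 𝓢(Space (fun i : (Lᶜ : Finset ι) => a i), 𝕜)) {A B : ℝ}
    (hg : ∀ u, ‖g u‖ ≤ A * ((1 + ‖u‖) ^ (K + 2 * Fintype.card ((i : ι) × Fin (a i))))⁻¹)
    (hh : ∀ z, ‖h z‖ ≤ B * ((1 + ‖z‖) ^ (2 * Fintype.card ((i : ι) × Fin (a i))))⁻¹)
    (x : Space (fun i : L => a i)) :
    ‖partialIntegral (dilate d r hr g)
        (dilate (fun i : (Lᶜ : Finset ι) => d i) (fun i => R i) (fun i => hR i) h) x‖ ≤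
      A * B * ((1 + ‖dilation (fun i : L => d i) (fun i => r i) (fun i => hr i) x‖) ^ K)⁻¹ *
        ∏ p : (i : (Lᶜ : Finset ι)) × Fin (a i),
          Real.pi / max (r p.1 ^ d p.1 p.2) (R p.1 ^ d p.1 p.2) := by
  set N := Fintype.card ((i : ι) × Fin (a i))
  have hA : 0 ≤ A := by
    have := (norm_nonneg _).trans (hg 0)
    simpa using this
  have hB : 0 ≤ B := by
    have := (norm_nonneg _).trans (hh 0)
    simpa using this
  set m : (i : (Lᶜ : Finset ι)) × Fin (a i) → ℝ :=
    fun p => max (r p.1 ^ d p.1 p.2) (R p.1 ^ d p.1 p.2)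
  have hm : ∀ p, 0 < m p := fun p => lt_max_of_lt_left (Real.rpow_pos_of_pos (hr _) _)
  set x' := dilation (fun i : L => d i) (fun i => r i) (fun i => hr i) x
  have hpt : ∀ y : Space (fun i : (Lᶜ : Finset ι) => a i),
      ‖dilate d r hr g (glue a L x y) *
        dilate (fun i : (Lᶜ : Finset ι) => d i) (fun i => R i) (fun i => hR i) h y‖ ≤
      A * B * ((1 + ‖x'‖) ^ K)⁻¹ * ∏ p, (1 + (m p * y p) ^ 2)⁻¹ := by
    intro y
    rw [norm_mul, dilate_apply, dilate_apply]
    set u := dilation d r hr (glue a L x y) with hu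
    set z := dilation (fun i : (Lᶜ : Finset ι) => d i) (fun i => R i) (fun i => hR i) y with hz
    have hu0 : 1 ≤ 1 + ‖u‖ := by linarith [norm_nonneg u]
    have hz0 : 1 ≤ 1 + ‖z‖ := by linarith [norm_nonneg z]
    have h1 : ‖x'‖ ≤ ‖u‖ := by
      have : restrict a L u = x' := by
        ext ⟨⟨i, hi⟩, k⟩
        change r i ^ d i k * glue a L x y ⟨i, k⟩ = r i ^ d i k * x ⟨⟨i, hi⟩, k⟩
        rw [glue_apply_of_mem a L x y ⟨i, k⟩ hi]
      exact this ▸ norm_restrict_le a L u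
    -- Each coordinate costs at most two powers of `(1 + ‖u‖) (1 + ‖z‖)`; this is the source of the
    -- exponent `2 * N`.
    have h2 : ∏ p, (1 + (m p * y p) ^ 2) ≤ (1 + ‖u‖) ^ (2 * N) * (1 + ‖z‖) ^ (2 * N) := by
      have h3 : ∀ p, 1 + (m p * y p) ^ 2 ≤ ((1 + ‖u‖) * (1 + ‖z‖)) ^ 2 := by
        rintro ⟨⟨i, hi⟩, k⟩
        have key : ∀ s b : ℝ, |s| ≤ b → 1 + s ^ 2 ≤ (1 + b) ^ 2 := fun s b hb => by
          nlinarith [sq_abs s, abs_nonneg s]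
        rcases max_choice (r i ^ d i k) (R i ^ d i k) with h | h
        · have e : m ⟨⟨i, hi⟩, k⟩ * y ⟨⟨i, hi⟩, k⟩ = u ⟨i, k⟩ := by
            rw [hu, dilation_apply, glue_apply_of_mem_compl a L x y ⟨i, k⟩ hi]
            exact congrArg (· * _) h
          rw [e]
          refine (key _ _ (PiLp.norm_apply_le u ⟨i, k⟩)).trans ?_
          gcongr
          exact le_mul_of_one_le_right (by linarith) hz0
        · have e : m ⟨⟨i, hi⟩, k⟩ * y ⟨⟨i, hi⟩, k⟩ = z ⟨⟨i, hi⟩, k⟩ := by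
            rw [hz, dilation_apply]
            exact congrArg (· * _) h
          rw [e]
          refine (key _ _ (PiLp.norm_apply_le z ⟨⟨i, hi⟩, k⟩)).trans ?_
          gcongr
          exact le_mul_of_one_le_left (by linarith) hu0
      refine (Finset.prod_le_prod (fun p _ => by positivity) fun p _ => h3 p).trans ?_
      rw [Finset.prod_const, ← pow_mul, ← mul_pow]
      refine pow_le_pow_right₀ (one_le_mul_of_one_le_of_one_le hu0 hz0)
        (Nat.mul_le_mul_left 2 ?_)
      rw [Finset.card_univ]
      refine Fintype.card_le_of_injective
        (fun p : (i : (Lᶜ : Finset ι)) × Fin (a i) => (⟨p.1, p.2⟩ : (i : ι) × Fin (a i))) ?_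
      rintro ⟨⟨i, hi⟩, k⟩ ⟨⟨j, hj⟩, k'⟩ hp
      simp only [Sigma.mk.injEq] at hp
      obtain ⟨rfl, h⟩ := hp
      rw [eq_of_heq h]
    calc ‖g u‖ * ‖h z‖ ≤ (A * ((1 + ‖u‖) ^ (K + 2 * N))⁻¹) * (B * ((1 + ‖z‖) ^ (2 * N))⁻¹) :=
          mul_le_mul (hg u) (hh z) (norm_nonneg _) (by positivity)
      _ = A * B * ((1 + ‖u‖) ^ K)⁻¹ * ((1 + ‖u‖) ^ (2 * N) * (1 + ‖z‖) ^ (2 * N))⁻¹ := by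
          rw [pow_add, mul_inv, mul_inv]; ring
      _ ≤ A * B * ((1 + ‖x'‖) ^ K)⁻¹ * (∏ p, (1 + (m p * y p) ^ 2))⁻¹ := by
          have : 0 < ∏ p, (1 + (m p * y p) ^ 2) := Finset.prod_pos fun p _ => by positivity
          gcongr
      _ = _ := by rw [Finset.prod_inv_distrib]
  have hI := integrable_prod_inv_one_add_mul_sq hm
  refine (MeasureTheory.norm_integral_le_of_norm_le (hI.const_mul _)
    (Filter.Eventually.of_forall hpt)).trans (le_of_eq ?_)
  rw [MeasureTheory.integral_const_mul, integral_prod_inv_one_add_mul_sq hm]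

/-- Integration by parts in the coordinates of the blocks in `S`. -/
theorem exists_norm_partialIntegral_derivList_eq {S : Finset ι} (hS : S ⊆ Lᶜ)
    (k l : List ((i : ι) × Fin (a i))) (x : Space (fun i : L => a i)) (f : 𝓢(Space a, 𝕜))
    (ψ : 𝓢(Space (fun i : (Lᶜ : Finset ι) => a i), 𝕜)) :
    ∃ (l₁ : List ((i : ι) × Fin (a i))) (l₂ : List ((i : (Lᶜ : Finset ι)) × Fin (a i))),
      l₁.length ≤ l.length ∧ l₂.length ≤ l.length ∧
      ‖partialIntegral (derivList k (dilate d r hr (derivList l f)))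
        (dilate (fun i : (Lᶜ : Finset ι) => d i) (fun i => R i) (fun i => hR i) ψ) x‖ =
      (l.map fun p => if p.1 ∈ S then (R p.1 / r p.1) ^ d p.1 p.2 else 1).prod *
      ‖partialIntegral (derivList k (dilate d r hr (derivList l₁ f)))
        (dilate (fun i : (Lᶜ : Finset ι) => d i) (fun i => R i) (fun i => hR i)
          (derivList l₂ ψ)) x‖ := by
  induction l generalizing f ψ with
  | nil => exact ⟨[], [], le_rfl, le_rfl, by simp [derivList]⟩
  | cons p l ih =>
    by_cases hp : p.1 ∈ S
    -- Moving the derivative costs `r^{-d}` to take it out of the dilate of `f`, and gives `R^d`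
    -- when it enters the dilate of `ψ`.
    · set p' : (i : (Lᶜ : Finset ι)) × Fin (a i) := ⟨⟨p.1, hS hp⟩, p.2⟩
      obtain ⟨l₁, l₂, h₁, h₂, h⟩ := ih f (∂_{unitVec (fun i : (Lᶜ : Finset ι) => a i) p'} ψ)
      refine ⟨l₁, l₂ ++ [p'], h₁.trans (by simp), by simpa using h₂, ?_⟩
      have hu : unitVec a p = embed a Lᶜ (unitVec (fun i : (Lᶜ : Finset ι) => a i) p') :=
        (embed_unitVec a Lᶜ p').symm
      have hrp := Real.rpow_pos_of_pos (hr p.1) (d p.1 p.2)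
      have hRp := Real.rpow_pos_of_pos (hR p.1) (d p.1 p.2)
      rw [derivList_append, derivList_singleton, List.map_cons, List.prod_cons, if_pos hp,
        mul_assoc, ← h, derivList_cons, dilate_lineDerivOp, derivList_smul, derivList_lineDerivOp,
        partialIntegral_smul_left, hu, partialIntegral_lineDerivOp, lineDerivOp_dilate,
        partialIntegral_smul_right, norm_smul, norm_neg, norm_smul, norm_inv,
        Real.norm_of_nonneg hrp.le, Real.norm_of_nonneg (by exact hRp.le),
        Real.div_rpow (hR p.1).le (hr p.1).le, ← mul_assoc, div_eq_inv_mul]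
    · obtain ⟨l₁, l₂, h₁, h₂, h⟩ := ih (∂_{unitVec a p} f) ψ
      refine ⟨l₁ ++ [p], l₂, by simpa using h₁, h₂.trans (by simp), ?_⟩
      rw [derivList_append, derivList_singleton, List.map_cons, List.prod_cons,
        if_neg hp, one_mul, ← h, derivList_cons, ← derivList_lineDerivOp]

end Estimates

/-- The gain of one block in `A`, with `2^s` the ratio of the two dilation parameters. For `s ≤ 0`
it is the power obtained from integration by parts, for `s > 0` the volume factor of a single
coordinate. -/
theorem ite_mul_prod_inv_max_le {κ : Type} [Fintype κ] [Nonempty κ] {δ : ℝ}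
    {e : κ → ℝ} (he : ∀ k, δ ≤ e k) (s : ℝ) :
    (if (2 : ℝ) ^ s ≤ 1 then ((2 : ℝ) ^ s) ^ δ else 1) * ∏ k, (max 1 (((2 : ℝ) ^ s) ^ e k))⁻¹ ≤
      2 ^ (-δ * |s|) := by
  classical
  have h1 : ∀ k, (max 1 (((2 : ℝ) ^ s) ^ e k))⁻¹ ≤ 1 := fun k =>
    inv_le_one_of_one_le₀ (le_max_left _ _)
  have h0 : ∀ k, 0 ≤ (max 1 (((2 : ℝ) ^ s) ^ e k))⁻¹ := fun k => by positivity
  rcases le_or_gt s 0 with hs | hs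
  · rw [if_pos (Real.rpow_le_one_of_one_le_of_nonpos (by norm_num) hs), abs_of_nonpos hs,
      ← Real.rpow_mul (by norm_num)]
    refine (mul_le_of_le_one_right (by positivity)
      (Finset.prod_le_one (fun k _ => h0 k) fun k _ => h1 k)).trans (le_of_eq ?_)
    congr 1; ring
  · rw [if_neg (not_le.2 (Real.one_lt_rpow (by norm_num) hs)), one_mul, abs_of_pos hs]
    obtain ⟨k⟩ := ‹Nonempty κ›
    rw [← Finset.mul_prod_erase _ _ (Finset.mem_univ k)]
    refine (mul_le_of_le_one_right (h0 k)
      (Finset.prod_le_one (fun k _ => h0 k) fun k _ => h1 k)).trans ?_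
    rw [neg_mul, Real.rpow_neg (by norm_num)]
    refine inv_anti₀ (by positivity) (le_max_of_le_right ?_)
    rw [← Real.rpow_mul (by norm_num)]
    exact Real.rpow_le_rpow_of_exponent_le (by norm_num) (by nlinarith [he k])

theorem blockDegree_coe {ι : Type} [LinearOrder ι] {a : ι → ℕ} (d : ∀ i, Fin (a i) → ℝ)
    {L : Finset ι} {m : ℕ} (c : Fin m → (i : L) × Fin (a i)) (l : L) :
    blockDegree d (fun t => (⟨(c t).1, (c t).2⟩ : (i : ι) × Fin (a i))) l
      = blockDegree (fun i : L => d i) c l := by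
  simp only [blockDegree, Subtype.ext_iff]

theorem blockDegree_eq_zero {ι : Type} [LinearOrder ι] {a : ι → ℕ} (d : ∀ i, Fin (a i) → ℝ)
    {L : Finset ι} {m : ℕ} (c : Fin m → (i : L) × Fin (a i)) {l : ι} (hl : l ∉ L) :
    blockDegree d (fun t => (⟨(c t).1, (c t).2⟩ : (i : ι) × Fin (a i))) l = 0 := by
  refine Finset.sum_eq_zero fun t _ => if_neg fun h => hl ?_
  rw [← h]
  exact (c t).1.2

/-- The coordinates chosen by `j`, one from each block in `A`. -/
def coordList {ι : Type} [LinearOrder ι] {a : ι → ℕ} (A : Finset ι) (j : ∀ i : A, Fin (a i)) :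
    List ((i : ι) × Fin (a i)) :=
  List.ofFn fun t : Fin A.card =>
    ⟨(A.orderIsoOfFin rfl t : ι), j (A.orderIsoOfFin rfl t)⟩

section Estimates

variable {𝕜 : Type} [RCLike 𝕜] {ι : Type} [Fintype ι] [LinearOrder ι] {a : ι → ℕ}
  (d : ∀ i, Fin (a i) → ℝ)

/-- `coordList` has exactly one coordinate in each block of `A`, so each block of `A ∩ S`
contributes one power `t^d`, which is at most `t^δ` because `t ≤ 1` on `S`. -/
theorem prod_coordList_le {δ : ℝ} (hδd : ∀ i k, δ ≤ d i k) {t : ι → ℝ} (ht : ∀ i, 0 < t i)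
    {L S : Finset ι} (hS : ∀ i, i ∈ S ↔ i ∈ Lᶜ ∧ t i ≤ 1) (A : Finset ι) (j : ∀ i : A, Fin (a i)) :
    ((coordList A j).map fun p => if p.1 ∈ S then t p.1 ^ d p.1 p.2 else 1).prod ≤
      ∏ i : (Lᶜ : Finset ι), if (i : ι) ∈ A then (if t i ≤ 1 then t i ^ δ else 1) else 1 := by
  rw [coordList, List.map_ofFn, List.prod_ofFn]
  set G : ι → ℝ := fun i => if i ∈ S then t i ^ δ else 1
  calc _ ≤ ∏ s : Fin A.card, G (A.orderIsoOfFin rfl s) := by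
        refine Finset.prod_le_prod (fun s _ => ?_) fun s _ => ?_
        · dsimp only [Function.comp_apply]
          have := ht (A.orderIsoOfFin rfl s)
          split_ifs <;> positivity
        · dsimp only [Function.comp_apply, G]
          split_ifs with h
          · exact Real.rpow_le_rpow_of_exponent_ge (ht _) ((hS _).1 h).2 (hδd _ _)
          · exact le_rfl
    _ = ∏ i : A, G i := (A.orderIsoOfFin rfl).toEquiv.prod_comp (fun i : A => G i)
    _ = ∏ i ∈ A, G i := Finset.prod_coe_sort A G
    _ = ∏ i, if i ∈ A then G i else 1 := by
        rw [Finset.prod_ite_mem Finset.univ A G, Finset.univ_inter]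
    _ = ∏ i ∈ Lᶜ, if i ∈ A then G i else 1 := by
        refine (Finset.prod_subset (Finset.subset_univ _) fun i _ hi => ?_).symm
        have : i ∉ S := fun h => hi ((hS i).1 h).1
        simp [G, this]
    _ = ∏ i : (Lᶜ : Finset ι), if (i : ι) ∈ A then G i else 1 :=
        (Finset.prod_coe_sort (Lᶜ : Finset ι) (fun i => if i ∈ A then G i else 1)).symm
    _ = _ := by
        refine Finset.prod_congr rfl fun i _ => ?_
        simp only [G, hS, i.2, true_and]

/-- The derivatives lie in blocks of `L`, so the blocks outside keep only their `L¹` normalization.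
That is the factor to be matched against the volume from the integration. -/
theorem prod_rpow_homDim_mul (L : Finset ι) {r : ι → ℝ} (hr : ∀ i, 0 < r i) {m : ℕ}
    (c : Fin m → (i : L) × Fin (a i)) :
    (∏ l, r l ^ homDim d l) *
      ∏ l, r l ^ blockDegree d (fun t => (⟨(c t).1, (c t).2⟩ : (i : ι) × Fin (a i))) l =
    (∏ l : L, r l ^ (homDim (fun i : L => d i) l + blockDegree (fun i : L => d i) c l)) *
      ∏ l : (Lᶜ : Finset ι), ∏ k, r l ^ d l k := by
  rw [← Finset.prod_mul_distrib]
  simp_rw [← Real.rpow_add (hr _)]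
  rw [← Finset.prod_mul_prod_compl L, ← Finset.prod_coe_sort L, ← Finset.prod_coe_sort Lᶜ]
  congr 1
  · refine Finset.prod_congr rfl fun l _ => ?_
    rw [blockDegree_coe]
    rfl
  · refine Finset.prod_congr rfl fun l _ => ?_
    rw [blockDegree_eq_zero d c (Finset.mem_compl.1 l.2), add_zero]
    exact Real.rpow_sum_of_pos (hr l) _ _

/-- The single-scale estimate behind the cancellation conditions: flag decay in the blocks of `L`,
and for each integrated block in `A` decay in the ratio of its two scales. The constants depend
neither on the scales nor on `R`. -/
theorem exists_partialIntegral_dilate_le (ha : ∀ l, 0 < a l) {δ : ℝ} (hδ : 0 < δ)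
    (hδd : ∀ i k, δ ≤ d i k) (L : Finset ι) (m : ℕ) :
    ∃ (C : ℝ) (M s : ℕ), 0 ≤ C ∧ ∀ (i : ι → ℤ), Monotone i → ∀ (R : ι → ℝ) (hR : ∀ l, 0 < R l)
      (c : Fin m → (i : L) × Fin (a i)) (A : Finset ι) (j : ∀ i : A, Fin (a i)) (f : 𝓢(Space a, 𝕜))
      (ψ : 𝓢(Space (fun i : (Lᶜ : Finset ι) => a i), 𝕜)) (x : Space (fun i : L => a i)),
      (∏ l, ((2 : ℝ) ^ (-i l)) ^ homDim d l) *
        ‖partialIntegral (derivList (List.ofFn fun t => (⟨(c t).1, (c t).2⟩ : (i : ι) × Fin (a i)))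
          (dilate d (fun l => (2 : ℝ) ^ (-i l)) (dyadic_pos i) (derivList (coordList A j) f)))
          (dilate (fun i : (Lᶜ : Finset ι) => d i) (fun i => R i) (fun i => hR i) ψ) x‖ ≤
      C * schwartzNorm M f * schwartzNorm s ψ *
        ((∏ l : (Lᶜ : Finset ι),
          if (l : ι) ∈ A then (2 : ℝ) ^ (-δ * |(i l : ℝ) + Real.logb 2 (R l)|) else 1) *
        ∏ l : L, scaleWeight (homDim (fun i : L => d i) l + blockDegree (fun i : L => d i) c l)
          (i l) (flagNorm (fun i : L => d i) l x)) := by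
  have hd : ∀ i k, 0 < d i k := fun i k => hδ.trans_le (hδd i k)
  obtain ⟨K, C₀, hC₀, hdecay⟩ := exists_decay_le_scaleWeight (fun i : L => d i) (fun l => ha l)
    (fun l k => hd l k) m
  set N := Fintype.card ((i : ι) × Fin (a i))
  set n := Fintype.card ι
  set P : ℝ := ∏ l : (Lᶜ : Finset ι), ∏ _k : Fin (a l), Real.pi
  have hP : 0 ≤ P := Finset.prod_nonneg fun _ _ => Finset.prod_nonneg fun _ _ => Real.pi_pos.le
  -- The norm of `f` pays for decay of order `K` in the blocks of `L`, order `2 * N` for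
  -- integration, `m` derivatives from `c` and at most `n` cancellation derivatives. That of `ψ`
  -- pays for integration and at most `n` derivatives received by parts.
  refine ⟨2 ^ (K + 2 * N + 1) * 2 ^ (2 * N + 1) * C₀ * P, K + 2 * N + (m + n), 2 * N + n,
    by positivity, fun i hi R hR c A j f ψ x => ?_⟩
  set M := K + 2 * N + (m + n)
  set s := 2 * N + n
  set r : ι → ℝ := fun l => (2 : ℝ) ^ (-i l) with hrdef
  have hr : ∀ l, 0 < r l := dyadic_pos i
  set t : ι → ℝ := fun l => R l / r l with htdef
  have ht : ∀ l, 0 < t l := fun l => div_pos (hR l) (hr l)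
  have ht2 : ∀ l, t l = 2 ^ ((i l : ℝ) + Real.logb 2 (R l)) := fun l => by
    rw [Real.rpow_add (by norm_num), Real.rpow_logb (by norm_num) (by norm_num) (hR l),
      Real.rpow_intCast, htdef, hrdef]
    simp only [zpow_neg, div_inv_eq_mul, mul_comm]
  -- Parts are integrated only in blocks where the factor `R / r` is a gain.
  set S : Finset ι := Lᶜ.filter fun l => t l ≤ 1
  have hS : ∀ i, i ∈ S ↔ i ∈ Lᶜ ∧ t i ≤ 1 := fun i => Finset.mem_filter
  set c' : Fin m → (i : ι) × Fin (a i) := fun t => ⟨(c t).1, (c t).2⟩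
  have hlen : (coordList A j).length ≤ n := by
    rw [coordList, List.length_ofFn]; exact Finset.card_le_univ A
  obtain ⟨l₁, l₂, h₁, h₂, heq⟩ := exists_norm_partialIntegral_derivList_eq d hr hR
    (fun i hi => ((hS i).1 hi).1) (List.ofFn c') (coordList A j) x f ψ
  set Λ := ((coordList A j).map fun p => if p.1 ∈ S then t p.1 ^ d p.1 p.2 else 1).prod with hΛdef
  have hΛ : 0 ≤ Λ := by
    refine List.prod_nonneg fun z hz => ?_
    obtain ⟨p, -, rfl⟩ := List.mem_map.1 hz
    have := ht p.1
    split_ifs <;> positivity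
  have hnf : ∀ u, ‖derivList (List.ofFn c') (derivList l₁ f) u‖ ≤
      2 ^ (K + 2 * N + 1) * schwartzNorm M f * ((1 + ‖u‖) ^ (K + 2 * N))⁻¹ := fun u => by
    rw [← derivList_append]
    refine norm_derivList_le (K + 2 * N) (m := m + n) _ ?_ le_rfl f u
    rw [List.length_append, List.length_ofFn]
    omega
  have hnψ : ∀ z, ‖derivList l₂ ψ z‖ ≤
      2 ^ (2 * N + 1) * schwartzNorm s ψ * ((1 + ‖z‖) ^ (2 * N))⁻¹ :=
    norm_derivList_le (2 * N) (m := n) _ (h₂.trans hlen) le_rfl ψ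
  have hI := norm_partialIntegral_dilate_le d hr hR K _ _ hnf hnψ x
  set H := ((1 + ‖dilation (fun i : L => d i) (fun i => r i) (fun i => hr i) x‖) ^ K)⁻¹
  have hD := hdecay c (fun l => i l) (fun l l' h => hi h) x
  set W := ∏ l : L, scaleWeight (homDim (fun i : L => d i) l + blockDegree (fun i : L => d i) c l)
          (i l) (flagNorm (fun i : L => d i) l x)
  have hW : 0 ≤ W := Finset.prod_nonneg fun l _ => scaleWeight_nonneg _ _ (flagNorm_nonneg _ _ _)
  rw [heq, derivList_ofFn_dilate, partialIntegral_smul_left, norm_smul,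
    Real.norm_of_nonneg (Finset.prod_nonneg fun l _ => (Real.rpow_pos_of_pos (hr l) _).le)]
  -- The normalization of the integrated blocks cancels against the volume, leaving only the ratio
  -- `t` of the dilation parameters.
  have hsplit : (∏ l : (Lᶜ : Finset ι), ∏ k, r l ^ d l k) *
      ∏ p : (i : (Lᶜ : Finset ι)) × Fin (a i),
          Real.pi / max (r p.1 ^ d p.1 p.2) (R p.1 ^ d p.1 p.2) =
      P * ∏ l : (Lᶜ : Finset ι), ∏ k, (max 1 (t l ^ d l k))⁻¹ := by
    rw [Fintype.prod_sigma, ← Finset.prod_mul_distrib, ← Finset.prod_mul_distrib]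
    refine Finset.prod_congr rfl fun l _ => ?_
    rw [← Finset.prod_mul_distrib, ← Finset.prod_mul_distrib]
    refine Finset.prod_congr rfl fun k _ => ?_
    have hrl := Real.rpow_pos_of_pos (hr l) (d l k)
    have : max (r l ^ d l k) (R l ^ d l k) = r l ^ d l k * max 1 (t l ^ d l k) := by
      rw [mul_max_of_nonneg _ _ hrl.le, mul_one, htdef]
      simp only
      rw [Real.div_rpow (hR l).le (hr l).le, mul_div_cancel₀ _ hrl.ne']
    rw [this]
    have : 0 < max 1 (t l ^ d l k) := by positivity
    field_simp
  have hgain : Λ * ∏ l : (Lᶜ : Finset ι), ∏ k, (max 1 (t l ^ d l k))⁻¹ ≤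
      ∏ l : (Lᶜ : Finset ι),
        if (l : ι) ∈ A then (2 : ℝ) ^ (-δ * |(i l : ℝ) + Real.logb 2 (R l)|) else 1 := by
    have hnn : ∀ l : (Lᶜ : Finset ι), 0 ≤ ∏ k, (max 1 (t l ^ d l k))⁻¹ := fun l =>
      Finset.prod_nonneg fun k _ => by positivity
    refine (mul_le_mul_of_nonneg_right (prod_coordList_le d hδd ht hS A j)
      (Finset.prod_nonneg fun l _ => hnn l)).trans ?_
    rw [← Finset.prod_mul_distrib]
    refine Finset.prod_le_prod (fun l _ => mul_nonneg ?_ (hnn l)) fun l _ => ?_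
    · have := ht l
      split_ifs <;> positivity
    · by_cases hA : (l : ι) ∈ A
      · have : Nonempty (Fin (a l)) := ⟨⟨0, ha l⟩⟩
        rw [if_pos hA, if_pos hA, ht2]
        exact ite_mul_prod_inv_max_le (hδd l) _
      · rw [if_neg hA, if_neg hA, one_mul]
        exact Finset.prod_le_one (fun k _ => by positivity)
          fun k _ => inv_le_one_of_one_le₀ (le_max_left _ _)
  set F := schwartzNorm M f
  set Ψ := schwartzNorm s ψ
  have hF : 0 ≤ F := schwartzNorm_nonneg _ _
  have hΨ : 0 ≤ Ψ := schwartzNorm_nonneg _ _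
  set PI := ‖partialIntegral (dilate d r hr (derivList (List.ofFn c') (derivList l₁ f)))
    (dilate (fun i : (Lᶜ : Finset ι) => d i) (fun i => R i) (fun i => hR i) (derivList l₂ ψ)) x‖
  set Q := ∏ l, r l ^ homDim d l
  set D' := ∏ l, r l ^ blockDegree d c' l
  have hQ : 0 ≤ Q := Finset.prod_nonneg fun l _ => (Real.rpow_pos_of_pos (hr l) _).le
  have hD' : 0 ≤ D' := Finset.prod_nonneg fun l _ => (Real.rpow_pos_of_pos (hr l) _).le
  have hQD := prod_rpow_homDim_mul d L hr c
  set X := ∏ l : L, r l ^ (homDim (fun i : L => d i) l + blockDegree (fun i : L => d i) c l)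
  set Y := ∏ l : (Lᶜ : Finset ι), ∏ k, r l ^ d l k
  set Z := ∏ p : (i : (Lᶜ : Finset ι)) × Fin (a i),
          Real.pi / max (r p.1 ^ d p.1 p.2) (R p.1 ^ d p.1 p.2)
  set V := ∏ l : (Lᶜ : Finset ι), ∏ k, (max 1 (t l ^ d l k))⁻¹
  set U := ∏ l : (Lᶜ : Finset ι),
        if (l : ι) ∈ A then (2 : ℝ) ^ (-δ * |(i l : ℝ) + Real.logb 2 (R l)|) else 1
  have hV : 0 ≤ V := Finset.prod_nonneg fun l _ => Finset.prod_nonneg fun k _ => by positivity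
  calc Q * (Λ * (D' * PI))
      ≤ Q * (Λ * (D' * (2 ^ (K + 2 * N + 1) * F * (2 ^ (2 * N + 1) * Ψ) * H * Z))) := by
        gcongr
    _ = 2 ^ (K + 2 * N + 1) * F * (2 ^ (2 * N + 1) * Ψ) * Λ * H * ((Q * D') * Z) := by ring
    _ = 2 ^ (K + 2 * N + 1) * F * (2 ^ (2 * N + 1) * Ψ) * (X * H) * P * (Λ * V) := by
        rw [show Q * D' = X * Y from hQD, mul_assoc X Y Z, hsplit]; ring
    _ ≤ 2 ^ (K + 2 * N + 1) * F * (2 ^ (2 * N + 1) * Ψ) * (C₀ * W) * P * U := by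
        have hXH : X * H ≤ C₀ * W := hD
        gcongr
    _ = _ := by ring

end Estimates

/-! ### Summation over the scales -/

section Summation

variable {n : ℕ}

/-- The weight at the scales `I` of the part of the decomposition belonging to `A`, after the
variables outside `L` have been integrated out. -/
def flagWeight (δ ε : ℝ) (L A : Finset (Fin n)) (ρ : Fin n → ℝ) (I : Index n) : ℝ :=
  ∏ l : (Lᶜ : Finset (Fin n)), if (l : Fin n) ∈ A then (2 : ℝ) ^ (-δ * |(I.1 l : ℝ) + ρ l|) else
    2 ^ (-ε * |((I.1 (Order.succ (l : Fin n)) - I.1 l : ℤ) : ℝ)|)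

theorem flagWeight_nonneg (δ ε : ℝ) (L A : Finset (Fin n)) (ρ : Fin n → ℝ) (I : Index n) :
    0 ≤ flagWeight δ ε L A ρ I :=
  Finset.prod_nonneg fun l _ => by split_ifs <;> positivity

/-- The tuple is recovered downwards from the largest index, which lies in `s`: outside `s`, the
scale at `k` is the next scale minus the known difference. -/
theorem injective_scaleDifferences {s : Finset (Fin n)}
    (hs : ∀ i, IsMax i → i ∈ s) :
    Function.Injective fun (I : Index n) (k : Fin n) =>
      if k ∈ s then I.1 k else I.1 (Order.succ k) - I.1 k := by
  intro I I' h
  refine Subtype.ext (funext fun k => ?_)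
  induction k using WellFoundedGT.induction with
  | ind k ih =>
    have hk := congrFun h k
    simp only at hk
    split_ifs at hk with h1
    · exact hk
    · have := ih _ (Order.lt_succ_of_not_isMax fun hm => h1 (hs k hm))
      omega

theorem exists_sum_flagWeight_le {δ ε : ℝ} (hδ : 0 < δ) (hε : 0 < ε) (L A : Finset (Fin n))
    (hA : ∀ i, IsMax i → i ∈ A) {q : L → ℝ} (hq : ∀ l, 0 < q l) :
    ∃ W : ℝ, 0 ≤ W ∧ ∀ (ρ : Fin n → ℝ) (D : L → ℝ), (∀ l, 0 < D l) → ∀ F : Finset (Index n),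
      ∑ I ∈ F, flagWeight δ ε L A ρ I * ∏ l : L, scaleWeight (q l) (I.1 l) (D l) ≤
        W * ∏ l, D l ^ (-q l) := by
  choose C hC0 hC using fun (x : {x : ℝ // 0 < x}) => exists_sum_two_rpow_neg_abs_le x.2
  set c : Fin n → ℝ := fun k => if k ∈ A then C ⟨δ, hδ⟩ else C ⟨ε, hε⟩
  set e : L → ℝ := fun l => C ⟨min (q l) 1, lt_min (hq l) one_pos⟩
  refine ⟨(∏ l : L, e l) * ∏ l : (Lᶜ : Finset (Fin n)), c l, ?_, fun ρ D hD F => ?_⟩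
  · refine mul_nonneg (Finset.prod_nonneg fun l _ => (hC0 _).le) (Finset.prod_nonneg fun l _ => ?_)
    simp only [c]
    split_ifs <;> exact (hC0 _).le
  -- The one-dimensional summand at `k`. Its integer argument is the scale itself for `k ∈ L ∪ A`,
  -- and the difference with the next scale otherwise.
  set G : Fin n → ℤ → ℝ := fun k i =>
    if h : k ∈ L then scaleWeight (q ⟨k, h⟩) i (D ⟨k, h⟩)
    else if k ∈ A then 2 ^ (-δ * |(i : ℝ) + ρ k|) else 2 ^ (-ε * |(i : ℝ)|)
  set B : Fin n → ℝ := fun k =>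
    if h : k ∈ L then D ⟨k, h⟩ ^ (-q ⟨k, h⟩) * e ⟨k, h⟩ else c k
  set s : Finset (Fin n) := L ∪ A
  have split : ∀ g : Fin n → ℝ,
      ∏ k, g k = (∏ l : L, g l) * ∏ l : (Lᶜ : Finset (Fin n)), g l := fun g => by
    rw [← Finset.prod_mul_prod_compl L, ← Finset.prod_coe_sort L, ← Finset.prod_coe_sort Lᶜ]
  have main := sum_prod_le_of_injective _ (injective_scaleDifferences (s := s)
    fun i hi => Finset.mem_union_right L (hA i hi)) G (fun k i => ?_) B (fun k T => ?_) F
  · calc _ = ∑ I ∈ F, ∏ k, G k (if k ∈ s then I.1 k else I.1 (Order.succ k) - I.1 k) := by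
          refine Finset.sum_congr rfl fun I _ => ?_
          rw [split, mul_comm, flagWeight]
          congr 1
          · refine Finset.prod_congr rfl fun l _ => ?_
            have h1 : (l : Fin n) ∈ s := Finset.mem_union_left A l.2
            simp only [G, l.2, h1, dite_true, if_true]
          · refine Finset.prod_congr rfl fun l _ => ?_
            have h1 : (l : Fin n) ∉ L := Finset.mem_compl.1 l.2
            have h2 : (l : Fin n) ∈ s ↔ (l : Fin n) ∈ A := by simp [s, h1]
            simp only [G, h1, dite_false, h2]
            split_ifs <;> rfl
      _ ≤ ∏ k, B k := main
      _ = _ := by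
          rw [split]
          have h1 : ∀ l : L, B l = D l ^ (-q l) * e l := fun l => by simp only [B, l.2, dite_true]
          have h2 : ∀ l : (Lᶜ : Finset (Fin n)), B l = c l := fun l => by
            simp only [B, Finset.mem_compl.1 l.2, dite_false]
          simp_rw [h1, h2, Finset.prod_mul_distrib]
          ring
  · simp only [G]
    split_ifs with h
    · exact scaleWeight_nonneg _ _ (hD _).le
    · positivity
    · positivity
  · simp only [G, B, c]
    split_ifs with h h'
    · refine (Finset.sum_le_sum fun i _ => scaleWeight_le (hq _) (hD _) i).trans ?_
      rw [← Finset.mul_sum]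
      exact mul_le_mul_of_nonneg_left (hC ⟨min (q ⟨k, h⟩) 1, lt_min (hq _) one_pos⟩ _ T)
        (Real.rpow_nonneg (hD _).le _)
    · exact hC ⟨δ, hδ⟩ _ T
    · simpa using hC ⟨ε, hε⟩ 0 T

end Summation

/-! ### Bounds for the sums of dilates -/

section Bounds

variable {𝕜 : Type} [RCLike 𝕜] {n : ℕ} {a : Fin n → ℕ} (d : ∀ l, Fin (a l) → ℝ)

open Classical in
/-- Weak cancellation with parameter `ε` relative to `I`, where the functions in the decomposition
have Schwartz norms bounded by `E`. -/
def HasWeakDecomposition (E : ℕ → ℝ) (ε : ℝ) (I : Index n) (φ : 𝓢(Space a, 𝕜)) : Prop :=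
  ∃ η : (A : Finset (Fin n)) → (∀ i : A, Fin (a i)) → 𝓢(Space a, 𝕜),
    (∀ A j M, schwartzNorm M (η A j) ≤ E M) ∧
    φ = ∑ A : Finset (Fin n) with ∀ i, IsMax i → i ∈ A,
      (∏ l ∈ Aᶜ, (2 : ℝ) ^ (-ε * ((I.1 (Order.succ l) : ℝ) - (I.1 l : ℝ)))) •
        ∑ j : (∀ i : A, Fin (a i)), derivList (coordList A j) (η A j)

/-- Bounds relative to `φ` become fixed numbers, so that later constants depend on those numbers
alone. The absolute value is there because `c M` may be negative. -/
theorem HasWeakCancellation.hasWeakDecomposition {c : ℕ → ℝ} {p : ℕ → ℕ} {ε : ℝ} {I : Index n}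
    {φ : 𝓢(Space a, 𝕜)} (h : HasWeakCancellation c p ε I φ) {C : ℕ → ℝ}
    (hC : ∀ M, schwartzNorm M φ ≤ C M) :
    HasWeakDecomposition (fun M => |c M| * C (M + p M)) ε I φ := by
  obtain ⟨η, hη, hφ⟩ := h
  refine ⟨η, fun A j M => (hη A j M).trans ?_, ?_⟩
  · exact mul_le_mul (le_abs_self _) (hC _) (schwartzNorm_nonneg _ _) (abs_nonneg _)
  · simp only [iteratedLineDerivOp_eq_derivList] at hφ
    exact hφ

/-- Lets a finite sum be treated as a full family in which the missing terms are zero, with the same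
constants. -/
theorem hasWeakDecomposition_zero {E : ℕ → ℝ} (hE : ∀ M, 0 ≤ E M) (ε : ℝ) (I : Index n) :
    HasWeakDecomposition E ε I (0 : 𝓢(Space a, 𝕜)) := by
  refine ⟨0, fun A j M => ?_, ?_⟩
  · change schwartzNorm M (0 : 𝓢(Space a, 𝕜)) ≤ E M
    rw [schwartzNorm, map_zero]
    exact hE M
  · have h0 : ∀ l : List ((i : Fin n) × Fin (a i)), derivList l (0 : 𝓢(Space a, 𝕜)) = 0 :=
      fun l => by simpa using derivList_smul l 0 (0 : 𝓢(Space a, 𝕜))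
    simp [h0]

theorem dyadicDilate_eq (I : Index n) (f : 𝓢(Space a, 𝕜)) :
    dyadicDilate d I f = (∏ l, ((2 : ℝ) ^ (-I.1 l)) ^ homDim d l) •
      dilate d (fun l => (2 : ℝ) ^ (-I.1 l)) (dyadic_pos I.1) f := by
  unfold dyadicDilate dilate
  congr 1
  rw [← Finset.sum_neg_distrib, Real.rpow_sum_of_pos (by norm_num)]
  refine Finset.prod_congr rfl fun l _ => ?_
  rw [← Real.rpow_intCast, ← Real.rpow_mul (by norm_num)]
  push_cast
  congr 1
  ring

theorem dyadicDilate_zero (I : Index n) : dyadicDilate d I (0 : 𝓢(Space a, 𝕜)) = 0 := by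
  simp [dyadicDilate]

theorem dyadicDilate_sum {α : Type*} (I : Index n) (s : Finset α) (f : α → 𝓢(Space a, 𝕜)) :
    dyadicDilate d I (∑ e ∈ s, f e) = ∑ e ∈ s, dyadicDilate d I (f e) := by
  simp only [dyadicDilate, map_sum, Finset.smul_sum]

theorem dyadicDilate_smul (I : Index n) (r : ℝ) (f : 𝓢(Space a, 𝕜)) :
    dyadicDilate d I (r • f) = r • dyadicDilate d I f := by
  unfold dyadicDilate
  rw [smul_comm]
  congr 1

/-- Schwartz decay alone suffices: every block retains its scale weight, and the sum over increasing
tuples is at most the sum over all of `ℤ^n`. The factor `1` is the trivial weight in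
`diffIneq_of_hasSum`. -/
theorem exists_size_bounds (ha : ∀ l, 0 < a l) (hd : ∀ l k, 0 < d l k) {N : ℕ → ℝ}
    (hN : ∀ M, 0 ≤ N M) :
    ∃ C W : ℕ → ℝ, (∀ m, 0 ≤ C m) ∧
      (∀ m (c : Fin m → (i : Fin n) × Fin (a i)) (D : Fin n → ℝ), (∀ l, 0 < D l) →
        ∀ F : Finset (Index n),
          ∑ I ∈ F, 1 * ∏ l, scaleWeight (homDim d l + blockDegree d c l) (I.1 l) (D l) ≤
            W m * ∏ l, D l ^ (-(homDim d l + blockDegree d c l))) ∧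
      ∀ φ : 𝓢(Space a, 𝕜), (∀ M, schwartzNorm M φ ≤ N M) →
        ∀ m (c : Fin m → (i : Fin n) × Fin (a i)) (I : Index n) x,
        ‖iteratedFDeriv ℝ m (dyadicDilate d I φ) x (fun t => unitVec a (c t))‖ ≤
          C m * (1 * ∏ l, scaleWeight (homDim d l + blockDegree d c l) (I.1 l)
            (flagNorm d l x)) := by
  choose K C₀ hC₀ hdecay using exists_decay_le_scaleWeight d ha hd
  choose S hS0 hS using fun (x : {x : ℝ // 0 < x}) => exists_sum_two_rpow_neg_abs_le x.2
  have hq : ∀ {m} (c : Fin m → (i : Fin n) × Fin (a i)) l, 0 < homDim d l + blockDegree d c l :=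
    fun c l => add_pos_of_pos_of_nonneg (homDim_pos d ha hd l) (blockDegree_nonneg d hd c l)
  set e : ∀ m, (Fin m → (i : Fin n) × Fin (a i)) → Fin n → ℝ := fun m c l =>
    S ⟨min (homDim d l + blockDegree d c l) 1, lt_min (hq c l) one_pos⟩
  have he : ∀ m c, 0 ≤ ∏ l, e m c l := fun m c => Finset.prod_nonneg fun l _ => (hS0 _).le
  refine ⟨fun m => 2 ^ (K m + 1) * N (K m + m) * C₀ m, fun m => ∑ c, ∏ l, e m c l,
    fun m => mul_nonneg (mul_nonneg (by positivity) (hN _)) (hC₀ m), ?_, ?_⟩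
  · intro m c D hD F
    simp only [one_mul]
    refine (sum_prod_le_of_injective (fun I : Index n => I.1) Subtype.val_injective
      (fun l i => scaleWeight (homDim d l + blockDegree d c l) i (D l))
      (fun l i => scaleWeight_nonneg _ _ (hD l).le)
      (fun l => D l ^ (-(homDim d l + blockDegree d c l)) * e m c l) (fun l T => ?_) F).trans ?_
    · refine (Finset.sum_le_sum fun i _ => scaleWeight_le (hq c l) (hD l) i).trans ?_
      rw [← Finset.mul_sum]
      exact mul_le_mul_of_nonneg_left (hS ⟨_, lt_min (hq c l) one_pos⟩ _ T)
        (Real.rpow_nonneg (hD l).le _)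
    · rw [Finset.prod_mul_distrib, mul_comm]
      refine mul_le_mul_of_nonneg_right ?_
        (Finset.prod_nonneg fun l _ => Real.rpow_nonneg (hD l).le _)
      exact Finset.single_le_sum (f := fun c => ∏ l, e m c l) (fun c _ => he m c)
        (Finset.mem_univ c)
  · intro φ hφ m c I x
    set r : Fin n → ℝ := fun l => (2 : ℝ) ^ (-I.1 l)
    have hr : ∀ l, 0 < r l := dyadic_pos I.1
    have hnn : ∀ f : Fin n → ℝ, 0 ≤ ∏ l, r l ^ f l := fun f =>
      Finset.prod_nonneg fun l _ => (Real.rpow_pos_of_pos (hr l) _).le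
    have h1 := norm_derivList_le (K m) (List.ofFn c) (List.length_ofFn).le le_rfl φ
      (dilation d r hr x)
    rw [← SchwartzMap.iteratedLineDerivOp_eq_iteratedFDeriv, iteratedLineDerivOp_eq_derivList,
      dyadicDilate_eq, derivList_smul, derivList_ofFn_dilate, smul_apply,
      smul_apply, norm_smul, norm_smul, Real.norm_of_nonneg (hnn _),
      Real.norm_of_nonneg (hnn _), ← mul_assoc, ← Finset.prod_mul_distrib, dilate_apply, one_mul]
    simp_rw [← Real.rpow_add (hr _)]
    have h2 := hdecay m c I.1 I.2 x
    set H := ((1 + ‖dilation d r hr x‖) ^ K m)⁻¹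
    calc _ ≤ (∏ l, r l ^ (homDim d l + blockDegree d c l)) *
          (2 ^ (K m + 1) * N (K m + m) * H) := by
          refine mul_le_mul_of_nonneg_left (h1.trans ?_) (hnn _)
          gcongr
          exact hφ _
      _ = 2 ^ (K m + 1) * N (K m + m) *
          ((∏ l, r l ^ (homDim d l + blockDegree d c l)) * H) := by ring
      _ ≤ 2 ^ (K m + 1) * N (K m + m) * (C₀ m * _) :=
          mul_le_mul_of_nonneg_left h2 (mul_nonneg (by positivity) (hN _))
      _ = _ := by ring

end Bounds

section Bounds

variable {𝕜 : Type} [RCLike 𝕜] {n : ℕ} {a : Fin n → ℕ} (d : ∀ l, Fin (a l) → ℝ)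

theorem exists_pos_le {κ : Type*} [Finite κ] {f : κ → ℝ} (hf : ∀ k, 0 < f k) :
    ∃ δ > 0, ∀ k, δ ≤ f k := by
  rcases isEmpty_or_nonempty κ with h | h
  · exact ⟨1, one_pos, fun k => h.elim k⟩
  · obtain ⟨k, hk⟩ := Finite.exists_min f
    exact ⟨f k, hf k, hk⟩

/-- The scales increase, so each factor with exponent `-ε` is at most `1`. Those belonging to blocks
of `L`, already summable through their scale weights, are discarded. -/
theorem prod_mul_prod_le_flagWeight (δ : ℝ) {ε : ℝ} (hε : 0 < ε) (L A : Finset (Fin n))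
    (ρ : Fin n → ℝ) (I : Index n) :
    (∏ l ∈ Aᶜ, (2 : ℝ) ^ (-ε * ((I.1 (Order.succ l) : ℝ) - (I.1 l : ℝ)))) *
      (∏ l : (Lᶜ : Finset (Fin n)),
          if (l : Fin n) ∈ A then (2 : ℝ) ^ (-δ * |(I.1 l : ℝ) + ρ l|) else 1) ≤
      flagWeight δ ε L A ρ I := by
  set g : Fin n → ℝ := fun l => 2 ^ (-ε * ((I.1 (Order.succ l) : ℝ) - (I.1 l : ℝ)))
  have hle : ∀ l, (I.1 l : ℝ) ≤ I.1 (Order.succ l) := fun l => by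
    exact_mod_cast I.2 (Order.le_succ l)
  have hg0 : ∀ l, 0 < g l := fun l => by positivity
  have hg1 : ∀ l, g l ≤ 1 := fun l =>
    Real.rpow_le_one_of_one_le_of_nonpos (by norm_num) (by nlinarith [hle l])
  have h1 : ∏ l ∈ Aᶜ, g l ≤ ∏ l : (Lᶜ : Finset (Fin n)), if (l : Fin n) ∈ A then 1 else g l := by
    rw [Finset.prod_coe_sort (Lᶜ : Finset (Fin n)) (fun l => if l ∈ A then 1 else g l)]
    calc ∏ l ∈ Aᶜ, g l = ∏ l ∈ Aᶜ, if l ∈ A then 1 else g l :=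
          Finset.prod_congr rfl fun l hl => by rw [if_neg (Finset.mem_compl.1 hl)]
      _ = ∏ l, if l ∈ A then 1 else g l :=
          Finset.prod_subset (Finset.subset_univ _) fun l _ hl => by
            rw [if_pos (by simpa using hl)]
      _ = (∏ l ∈ L, if l ∈ A then 1 else g l) * ∏ l ∈ Lᶜ, if l ∈ A then 1 else g l :=
          (Finset.prod_mul_prod_compl L _).symm
      _ ≤ _ := by
          refine mul_le_of_le_one_left (Finset.prod_nonneg fun l _ => ?_)
            (Finset.prod_le_one (fun l _ => ?_) fun l _ => ?_)
          · split_ifs; exacts [zero_le_one, (hg0 l).le]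
          · split_ifs; exacts [zero_le_one, (hg0 l).le]
          · split_ifs; exacts [le_rfl, hg1 l]
  refine (mul_le_mul_of_nonneg_right h1 (Finset.prod_nonneg fun l _ => ?_)).trans (le_of_eq ?_)
  · split_ifs <;> positivity
  · rw [← Finset.prod_mul_distrib, flagWeight]
    refine Finset.prod_congr rfl fun l _ => ?_
    split_ifs
    · rw [one_mul]
    · rw [mul_one, Int.cast_sub, abs_of_nonneg (sub_nonneg.2 (hle l))]

theorem exists_partial_bounds (ha : ∀ l, 0 < a l) (hd : ∀ l k, 0 < d l k) {E : ℕ → ℝ}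
    (hE : ∀ M, 0 ≤ E M) {ε : ℝ} (hε : 0 < ε) (L : Finset (Fin n)) :
    ∃ (C W : ℕ → ℝ) (s : ℕ → ℕ), (∀ m, 0 ≤ C m) ∧ ∀ (R : Fin n → ℝ) (hR : ∀ l, 0 < R l),
      ∃ w : Index n → ℝ, (∀ I, 0 ≤ w I) ∧
      (∀ m (c : Fin m → (i : L) × Fin (a i)) (D : L → ℝ), (∀ l, 0 < D l) →
        ∀ F : Finset (Index n), ∑ I ∈ F, w I * ∏ l : L,
          scaleWeight (homDim (fun i : L => d i) l + blockDegree (fun i : L => d i) c l)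
            (I.1 l) (D l) ≤
          W m * ∏ l, D l ^ (-(homDim (fun i : L => d i) l + blockDegree (fun i : L => d i) c l))) ∧
      ∀ (I : Index n) (φ : 𝓢(Space a, 𝕜)), HasWeakDecomposition E ε I φ →
        ∀ (ψ : 𝓢(Space (fun i : (Lᶜ : Finset (Fin n)) => a i), 𝕜)) m
          (c : Fin m → (i : L) × Fin (a i)) x,
        ‖iteratedFDeriv ℝ m (partialIntegral (dyadicDilate d I φ)
          (dilate (fun i : (Lᶜ : Finset (Fin n)) => d i) (fun i => R i) (fun i => hR i) ψ)) x
            (fun t => unitVec (fun i : L => a i) (c t))‖ ≤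
          C m * schwartzNorm (s m) ψ * (w I * ∏ l : L,
            scaleWeight (homDim (fun i : L => d i) l + blockDegree (fun i : L => d i) c l)
              (I.1 l) (flagNorm (fun i : L => d i) l x)) := by
  classical
  obtain ⟨δ, hδ, hδd'⟩ := exists_pos_le fun p : (i : Fin n) × Fin (a i) => hd p.1 p.2
  have hδd : ∀ i k, δ ≤ d i k := fun i k => hδd' ⟨i, k⟩
  have hq : ∀ {m} (c : Fin m → (i : L) × Fin (a i)) l,
      0 < homDim (fun i : L => d i) l + blockDegree (fun i : L => d i) c l := fun c l =>
    add_pos_of_pos_of_nonneg (homDim_pos (fun i : L => d i) (fun i => ha i) (fun i => hd i) l)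
      (blockDegree_nonneg (fun i : L => d i) (fun i => hd i) c l)
  choose C₁ M s hC₁ hone using exists_partialIntegral_dilate_le (𝕜 := 𝕜) d ha hδ hδd L
  set 𝒜 : Finset (Finset (Fin n)) := {A | ∀ i, IsMax i → i ∈ A}
  have hmem : ∀ A : 𝒜, ∀ i, IsMax i → i ∈ A.1 := fun A => (Finset.mem_filter.1 A.2).2
  choose W hW0 hW using fun (A : 𝒜) (m : ℕ) (c : Fin m → (i : L) × Fin (a i)) =>
    exists_sum_flagWeight_le hδ hε L A.1 (hmem A) (hq c)
  set Γ : ℝ := ∑ A : Finset (Fin n), (Fintype.card (∀ i : A, Fin (a i)) : ℝ)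
  have hΓ : 0 ≤ Γ := Finset.sum_nonneg fun A _ => Nat.cast_nonneg _
  refine ⟨fun m => Γ * (C₁ m * E (M m)), fun m => ∑ c, ∑ A, W A m c, s,
    fun m => mul_nonneg hΓ (mul_nonneg (hC₁ m) (hE _)), fun R hR => ?_⟩
  set ρ : Fin n → ℝ := fun l => Real.logb 2 (R l)
  -- The weight collects all admissible sets `A`. It depends on `R` only through the shifts `ρ`,
  -- over which the sums are uniform.
  refine ⟨fun I => ∑ A : 𝒜, flagWeight δ ε L A.1 ρ I,
    fun I => Finset.sum_nonneg fun A _ => flagWeight_nonneg _ _ _ _ _ _, ?_, ?_⟩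
  · intro m c D hD F
    rw [Finset.sum_congr rfl fun I _ => Finset.sum_mul _ _ _, Finset.sum_comm]
    refine (Finset.sum_le_sum fun A _ => hW A m c ρ D hD F).trans ?_
    rw [← Finset.sum_mul]
    refine mul_le_mul_of_nonneg_right ?_
      (Finset.prod_nonneg fun l _ => Real.rpow_nonneg (hD l).le _)
    exact Finset.single_le_sum (f := fun c => ∑ A, W A m c)
      (fun c _ => Finset.sum_nonneg fun A _ => hW0 A m c) (Finset.mem_univ c)
  · rintro I φ ⟨η, hη, hφ⟩ ψ m c x
    set c' : Fin m → (i : Fin n) × Fin (a i) := fun t => ⟨(c t).1, (c t).2⟩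
    set χ := dilate (fun i : (Lᶜ : Finset (Fin n)) => d i) (fun i => R i) (fun i => hR i) ψ
    set P := ∏ l, ((2 : ℝ) ^ (-I.1 l)) ^ homDim d l
    have hP : 0 ≤ P := by positivity
    set κ : Finset (Fin n) → ℝ := fun A =>
      ∏ l ∈ Aᶜ, (2 : ℝ) ^ (-ε * ((I.1 (Order.succ l) : ℝ) - (I.1 l : ℝ)))
    have hκ : ∀ A, 0 ≤ κ A := fun A => Finset.prod_nonneg fun l _ => by positivity
    set T : ∀ A : Finset (Fin n), (∀ i : A, Fin (a i)) → 𝕜 := fun A j =>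
      partialIntegral (derivList (List.ofFn c')
        (dilate d (fun l => (2 : ℝ) ^ (-I.1 l)) (dyadic_pos I.1)
          (derivList (coordList A j) (η A j)))) χ x
    have e1 : iteratedFDeriv ℝ m (partialIntegral (dyadicDilate d I φ) χ) x
        (fun t => unitVec (fun i : L => a i) (c t)) = ∑ A ∈ 𝒜, κ A • ∑ j, P • T A j := by
      rw [iteratedFDeriv_partialIntegral]
      have : (fun t => embed a L (unitVec (fun i : L => a i) (c t))) =
          fun t => unitVec a (c' t) := funext fun t => embed_unitVec a L (c t)
      rw [this, iteratedLineDerivOp_eq_derivList, hφ]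
      simp only [dyadicDilate_sum, dyadicDilate_smul, derivList_sum, derivList_smul,
        partialIntegral_sum, partialIntegral_smul_left]
      simp only [dyadicDilate_eq, derivList_smul, partialIntegral_smul_left]
      rfl
    set Ψ := schwartzNorm (s m) ψ
    have hΨ : 0 ≤ Ψ := schwartzNorm_nonneg _ _
    set V := ∏ l : L, scaleWeight (homDim (fun i : L => d i) l + blockDegree (fun i : L => d i) c l)
      (I.1 l) (flagNorm (fun i : L => d i) l x)
    have hV : 0 ≤ V := Finset.prod_nonneg fun l _ => scaleWeight_nonneg _ _ (flagNorm_nonneg _ _ _)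
    have hT : ∀ A j, κ A * (P * ‖T A j‖) ≤
        C₁ m * E (M m) * Ψ * (flagWeight δ ε L A ρ I * V) := by
      intro A j
      have h1 := hone m I.1 I.2 R hR c A j (η A j) ψ x
      set U := ∏ l : (Lᶜ : Finset (Fin n)),
          if (l : Fin n) ∈ A then (2 : ℝ) ^ (-δ * |(I.1 l : ℝ) + ρ l|) else 1
      have hU : 0 ≤ U := Finset.prod_nonneg fun l _ => by split_ifs <;> positivity
      have h2 : κ A * U ≤ flagWeight δ ε L A ρ I := prod_mul_prod_le_flagWeight δ hε L A ρ I
      have hC := hC₁ m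
      have hEm := hE (M m)
      calc κ A * (P * ‖T A j‖) ≤ κ A * (C₁ m * schwartzNorm (M m) (η A j) * Ψ * (U * V)) :=
            mul_le_mul_of_nonneg_left h1 (hκ A)
        _ ≤ κ A * (C₁ m * E (M m) * Ψ * (U * V)) := by
            have := hκ A
            gcongr
            exact hη A j _
        _ = C₁ m * E (M m) * Ψ * ((κ A * U) * V) := by ring
        _ ≤ _ := by gcongr
    rw [e1]
    calc ‖∑ A ∈ 𝒜, κ A • ∑ j, P • T A j‖
        ≤ ∑ A ∈ 𝒜, ∑ j : (∀ i : A, Fin (a i)), κ A * (P * ‖T A j‖) := by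
          refine (norm_sum_le _ _).trans (Finset.sum_le_sum fun A _ => ?_)
          rw [norm_smul, Real.norm_of_nonneg (hκ A), ← Finset.mul_sum]
          refine mul_le_mul_of_nonneg_left ((norm_sum_le _ _).trans (le_of_eq ?_)) (hκ A)
          exact Finset.sum_congr rfl fun j _ => by rw [norm_smul, Real.norm_of_nonneg hP]
      _ ≤ ∑ A ∈ 𝒜, Γ * (C₁ m * E (M m) * Ψ * (flagWeight δ ε L A ρ I * V)) := by
          refine Finset.sum_le_sum fun A _ => ?_
          refine (Finset.sum_le_sum fun j _ => hT A j).trans ?_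
          rw [Finset.sum_const, nsmul_eq_mul, Finset.card_univ]
          refine mul_le_mul_of_nonneg_right ?_ ?_
          · exact Finset.single_le_sum
              (f := fun A : Finset (Fin n) => (Fintype.card (∀ i : A, Fin (a i)) : ℝ))
              (fun A _ => Nat.cast_nonneg _) (Finset.mem_univ A)
          · exact mul_nonneg (mul_nonneg (mul_nonneg (hC₁ m) (hE _)) hΨ)
              (mul_nonneg (flagWeight_nonneg _ _ _ _ _ _) hV)
      _ = _ := by
          dsimp only
          rw [Finset.sum_coe_sort 𝒜 (fun A => flagWeight δ ε L A ρ I), ← Finset.mul_sum,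
            ← Finset.mul_sum, ← Finset.sum_mul]
          ring

end Bounds

/-! ### Convergence and flag kernel estimates -/

section Convergence

variable {𝕜 : Type} [RCLike 𝕜]

/-- A single Schwartz norm controls all terms with summable coefficients, so the limit is bounded by
that same norm and is therefore continuous. -/
theorem exists_hasSum_functional {α ι : Type} [Fintype ι] {a : ι → ℕ}
    (T : α → 𝓢(Space a, 𝕜) →L[𝕜] 𝕜) {w : α → ℝ} (hw : Summable w) (hw0 : ∀ e, 0 ≤ w e) {C : ℝ}
    (hC : 0 ≤ C) {s : ℕ} (h : ∀ e ψ, ‖T e ψ‖ ≤ w e * (C * schwartzNorm s ψ)) :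
    ∃ T' : 𝓢(Space a, 𝕜) →L[𝕜] 𝕜, ∀ ψ, HasSum (fun e => T e ψ) (T' ψ) := by
  have hs : ∀ ψ, Summable fun e => T e ψ := fun ψ =>
    (hw.mul_right _).of_norm_bounded fun e => h e ψ
  refine ⟨SchwartzMap.mkCLMtoNormedSpace (σ := RingHom.id 𝕜) (fun ψ => ∑' e, T e ψ)
    (fun f g => ?_) (fun b f => ?_)
    ⟨(Finset.range (s + 1) ×ˢ Finset.range (s + 1)).filter (fun q => q.1 + q.2 ≤ s),
      (∑' e, w e) * C, mul_nonneg (tsum_nonneg hw0) hC,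
      fun f => ?_⟩, fun ψ => (hs ψ).hasSum⟩
  · simp only [map_add]
    exact (hs f).tsum_add (hs g)
  · simp only [map_smul, smul_eq_mul, RingHom.id_apply]
    exact tsum_mul_left
  · exact (tsum_of_norm_bounded (hw.mul_right _).hasSum fun e => h e f).trans
      (by rw [tsum_mul_right, mul_assoc]; rfl)

/-- The space `Space a`, seen as the space of the blocks outside the empty set. -/
def restrictEmptyCompl {ι : Type} [Fintype ι] [LinearOrder ι] (a : ι → ℕ) :
    Space a ≃L[ℝ] Space (fun i : ((∅ : Finset ι)ᶜ : Finset ι) => a i) :=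
  ContinuousLinearEquiv.equivOfInverse (restrict a ∅ᶜ) (embed a ∅ᶜ)
    (fun x => by
      have h := glue_restrict a ∅ x
      rw [glue, Subsingleton.elim (restrict a ∅ x) 0, map_zero, zero_add] at h
      exact h)
    (fun y => by
      have h := restrict_glue_right a ∅ 0 y
      rw [glue, map_zero, zero_add] at h
      exact h)

variable {n : ℕ} {a : Fin n → ℕ} (d : ∀ l, Fin (a l) → ℝ)

theorem dilate_one {ι : Type} [Fintype ι] {a : ι → ℕ} (d : ∀ i, Fin (a i) → ℝ)
    (h : ∀ i : ι, (0 : ℝ) < (fun _ => 1) i) (f : 𝓢(Space a, 𝕜)) :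
    dilate d (fun _ => 1) h f = f := by
  ext x
  rw [dilate_apply]
  congr 1
  ext p
  rw [dilation_apply, Real.one_rpow, one_mul]

/-- The constants are chosen before the family `φ`. This order of quantifiers is what makes the
bounds for finite partial sums uniform. -/
theorem exists_isFlagKernelWith (ha : ∀ l, 0 < a l) (hd : ∀ l k, 0 < d l k) {N E : ℕ → ℝ}
    (hN : ∀ M, 0 ≤ N M) (hE : ∀ M, 0 ≤ E M) {ε : ℝ} (hε : 0 < ε) :
    ∃ (A : ℕ → ℝ) (B : Finset (Fin n) → ℕ → ℝ) (s : Finset (Fin n) → ℕ → ℕ),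
      ∀ φ : Index n → 𝓢(Space a, 𝕜), (∀ I M, schwartzNorm M (φ I) ≤ N M) →
        (∀ I, HasWeakDecomposition E ε I (φ I)) →
        ∃ 𝓚 : 𝓢(Space a, 𝕜) →L[𝕜] 𝕜,
          (∀ ψ, HasSum (fun I => ∫ x, dyadicDilate d I (φ I) x * ψ x) (𝓚 ψ)) ∧
          IsFlagKernelWith a d 𝓚 A B s := by
  obtain ⟨C, W, hC, hW, hsize⟩ := exists_size_bounds (𝕜 := 𝕜) d ha hd hN
  choose C' W' s hC' hpart using exists_partial_bounds (𝕜 := 𝕜) d ha hd hE hε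
  refine ⟨fun m => C m * W m, fun L m => C' L m * W' L m, s, fun φ hφN hφE => ?_⟩
  set g : Index n → 𝓢(Space a, 𝕜) := fun I => dyadicDilate d I (φ I)
  have hint : ∀ I (θ : 𝓢(Space a, 𝕜)), MeasureTheory.Integrable fun x => g I x * θ x := fun I θ =>
    (g I).integrable.mul_bdd θ.continuous.aestronglyMeasurable
      (Filter.Eventually.of_forall fun x => θ.norm_le_seminorm ℝ x)
  obtain ⟨𝓚, h𝓚⟩ : ∃ 𝓚 : 𝓢(Space a, 𝕜) →L[𝕜] 𝕜,
      ∀ ψ, HasSum (fun I => ∫ x, g I x * ψ x) (𝓚 ψ) := by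
    -- With `L = ∅` all variables are integrated, so the partial integral is the full pairing and
    -- the bound on `w` has no distances left: it is plain summability.
    obtain ⟨w, hw0, hwsum, hbound⟩ := hpart ∅ (fun _ => 1) fun _ => one_pos
    have hwS : Summable w := by
      refine summable_of_sum_le hw0 (c := W' ∅ 0) fun F => ?_
      simpa using hwsum 0 Fin.elim0 (fun _ => 1) (fun _ => one_pos) F
    set e := restrictEmptyCompl a
    set T : Index n → 𝓢(Space (fun i : ((∅ : Finset (Fin n))ᶜ : Finset (Fin n)) => a i), 𝕜)
        →L[𝕜] 𝕜 := fun I =>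
      (toDistribution (g I)).comp (SchwartzMap.compCLMOfContinuousLinearEquiv 𝕜 e)
    -- The space with no blocks is a point. The pairing is an integral over it, so its finite total
    -- mass enters the constant.
    set V := MeasureTheory.volume.real
      (Set.univ : Set (Space (fun i : (∅ : Finset (Fin n)) => a i)))
    have hT : ∀ I ψ, ‖T I ψ‖ ≤ w I * ((C' ∅ 0 * V) * schwartzNorm (s ∅ 0) ψ) := by
      intro I ψ
      have h1 : T I ψ =
          ∫ z, g I z * (ψ (restrict a ∅ᶜ z) * (fun _ => (1 : 𝕜)) (restrict a ∅ z)) := by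
        change ∫ z, g I z * ψ (restrict a ∅ᶜ z) = _
        simp only [mul_one]
      have h2 := integral_mul_eq_integral_partialIntegral ψ (g I) (fun _ => (1 : 𝕜)) (by
        simp only [mul_one]
        exact hint I (SchwartzMap.compCLMOfContinuousLinearEquiv 𝕜 e ψ))
      rw [h1, h2]
      refine (MeasureTheory.norm_integral_le_of_norm_le_const
        (C := C' ∅ 0 * schwartzNorm (s ∅ 0) ψ * w I)
        (Filter.Eventually.of_forall fun x => ?_)).trans (le_of_eq ?_)
      · have := hbound I (φ I) (hφE I) ψ 0 Fin.elim0 x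
        rw [dilate_one] at this
        simpa using this
      · ring
    obtain ⟨T', hT'⟩ := exists_hasSum_functional T hwS hw0
      (mul_nonneg (hC' ∅ 0) MeasureTheory.measureReal_nonneg) hT
    refine ⟨T'.comp (SchwartzMap.compCLMOfContinuousLinearEquiv 𝕜 e.symm), fun ψ => ?_⟩
    have h1 : ∀ I, ∫ x, g I x * ψ x
        = T I (SchwartzMap.compCLMOfContinuousLinearEquiv 𝕜 e.symm ψ) := fun I => by
      change _ = ∫ z, g I z * ψ (e.symm (e z))
      simp only [e.symm_apply_apply]
    simp_rw [h1]
    exact hT' _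
  refine ⟨𝓚, h𝓚, ?_, ?_⟩
  · exact diffIneq_of_hasSum d ha hd (fun I => (g I).smooth ⊤) (fun _ => zero_le_one) hC
      (fun m c I x => hsize (φ I) (hφN I) m c I x) hW h𝓚
  · intro L ψ _ R hR
    -- The bounds are stated for dilation parameters on all blocks; on `L`, where they play no role,
    -- they are set to `1`.
    obtain ⟨R', hR', rfl⟩ : ∃ R' : Fin n → ℝ, ∃ _ : ∀ l, 0 < R' l,
        R = fun i : (Lᶜ : Finset (Fin n)) => R' i := by
      refine ⟨fun l => if h : l ∈ Lᶜ then R ⟨l, h⟩ else 1, fun l => ?_, funext fun i => ?_⟩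
      · dsimp only
        split_ifs
        exacts [hR _, one_pos]
      · simp only [i.2, dite_true]
    obtain ⟨w, hw0, hwsum, hbound⟩ := hpart L R' hR'
    set χ := dilate (fun i : (Lᶜ : Finset (Fin n)) => d i) (fun i => R' i) hR ψ
    have e : (fun m => C' L m * W' L m * schwartzNorm (s L m) ψ) =
        fun m => C' L m * schwartzNorm (s L m) ψ * W' L m := funext fun m => by ring
    rw [e]
    refine diffIneq_of_hasSum (fun i : L => d i) (fun l => ha l) (fun l k => hd l k)
      (g := fun I => partialIntegral (g I) χ) (fun I => contDiff_partialIntegral _ _) hw0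
      (C := fun m => C' L m * schwartzNorm (s L m) ψ)
      (fun m => mul_nonneg (hC' L m) (schwartzNorm_nonneg _ _))
      (fun m c I x => hbound I (φ I) (hφE I) ψ m c x) hwsum fun θ => ?_
    -- By Fubini, pairing with the tensor product is pairing the partial integral with `θ`, so the
    -- series already known to converge is the one required.
    convert h𝓚 (tensor L χ θ) using 2 with I
    · exact (integral_mul_eq_integral_partialIntegral χ (g I) θ (hint I (tensor L χ θ))).symm
    · rfl

end Convergence

end FlagKernel

end

/-! ### Uniform bounds for finite sums and the limit kernel -/

theorem mainTheorem4 {𝕜 : Type} [RCLike 𝕜] (n : ℕ) (hn : 0 < n)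
    (a : Fin n → ℕ) (ha : ∀ l, 0 < a l)
    (d : ∀ l, Fin (a l) → ℝ) (hd : ∀ l k, 0 < d l k)
    (φ : FlagKernel.Index n → 𝓢(FlagKernel.Space a, 𝕜))
    (hφ : ∀ M : ℕ, ∃ C : ℝ, ∀ I, FlagKernel.schwartzNorm M (φ I) ≤ C)
    (ε : ℝ) (hε : 0 < ε) (c : ℕ → ℝ) (p : ℕ → ℕ)
    (hcancel : ∀ I, FlagKernel.HasWeakCancellation c p ε I (φ I)) :
    (∃ (A : ℕ → ℝ) (B : Finset (Fin n) → ℕ → ℝ) (s : Finset (Fin n) → ℕ → ℕ),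
      ∀ F : Finset (FlagKernel.Index n),
        FlagKernel.IsFlagKernelWith a d
          (FlagKernel.toDistribution (∑ I ∈ F, FlagKernel.dyadicDilate d I (φ I))) A B s) ∧
    ∃ 𝓚 : 𝓢(FlagKernel.Space a, 𝕜) →L[𝕜] 𝕜,
      FlagKernel.IsFlagKernel a d 𝓚 ∧
      ∀ F : ℕ → Finset (FlagKernel.Index n), Monotone F → (∀ I, ∃ m, I ∈ F m) →
        ∀ ψ : 𝓢(FlagKernel.Space a, 𝕜),
          Filter.Tendsto
            (fun m => ∑ I ∈ F m, ∫ x, FlagKernel.dyadicDilate d I (φ I) x * ψ x)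
            Filter.atTop (𝓝 (𝓚 ψ)) := by
  classical
  choose N₀ hN₀ using hφ
  set N : ℕ → ℝ := fun M => max 0 (N₀ M)
  have hN0 : ∀ M, 0 ≤ N M := fun M => le_max_left _ _
  have hN : ∀ I M, FlagKernel.schwartzNorm M (φ I) ≤ N M := fun I M =>
    (hN₀ M I).trans (le_max_right _ _)
  have hE0 : ∀ M, 0 ≤ |c M| * N (M + p M) := fun M => mul_nonneg (abs_nonneg _) (hN0 _)
  have hE := fun I => (hcancel I).hasWeakDecomposition (hN I)
  obtain ⟨A, B, s, h⟩ := FlagKernel.exists_isFlagKernelWith (𝕜 := 𝕜) d ha hd hN0 hE0 hε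
  refine ⟨⟨A, B, s, fun F => ?_⟩, ?_⟩
  -- Setting the terms outside `F` to zero satisfies the same bounds, and the resulting series is
  -- the finite sum.
  · obtain ⟨𝓚, h𝓚, hflag⟩ := h (fun I => if I ∈ F then φ I else 0)
      (fun I M => by
        split_ifs
        · exact hN I M
        · rw [FlagKernel.schwartzNorm, map_zero]; exact hN0 M)
      (fun I => by
        split_ifs
        · exact hE I
        · exact FlagKernel.hasWeakDecomposition_zero hE0 ε I)
    have e : FlagKernel.toDistribution (∑ I ∈ F, FlagKernel.dyadicDilate d I (φ I)) = 𝓚 := by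
      ext ψ
      have h0 := hasSum_sum_of_ne_finset_zero (s := F) (L := SummationFilter.unconditional _)
        (f := fun I => ∫ x, FlagKernel.dyadicDilate d I (if I ∈ F then φ I else 0) x * ψ x)
        fun I hI => by
          rw [if_neg hI, FlagKernel.dyadicDilate_zero]
          simp
      rw [(h𝓚 ψ).unique h0, FlagKernel.toDistribution_apply]
      simp only [sum_apply, Finset.sum_mul]
      rw [MeasureTheory.integral_finsetSum]
      · exact Finset.sum_congr rfl fun I hI => by rw [if_pos hI]
      · exact fun I _ => (FlagKernel.dyadicDilate d I (φ I)).integrable.mul_bdd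
          ψ.continuous.aestronglyMeasurable
          (Filter.Eventually.of_forall fun x => ψ.norm_le_seminorm ℝ x)
    rw [e]
    exact hflag
  · obtain ⟨𝓚, h𝓚, hflag⟩ := h φ hN hE
    -- An increasing exhaustion by finite sets tends to infinity among all finite sets, so
    -- unconditional convergence gives the same limit along every one.
    exact ⟨𝓚, ⟨A, B, s, hflag⟩, fun F hF hF' ψ =>
      (h𝓚 ψ).comp (Filter.tendsto_atTop_finset_of_monotone hF hF')⟩
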